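/- Let $\alpha,\beta\in(0,\infty)$, let $$P=\begin{pmatrix}\frac1{1+\alpha}&\frac\alpha{1+\alpha}\\[2pt] \frac\beta{1+\beta}&\frac1{1+\beta}\end{pmatrix}$$ (rows and columns indexed by $0,1$), and let $\pi$ be a probability distribution on $\{0,1\}$ with $\pi(0),\pi(1)>0$. Let $\mu$ be the Markov measure on $X=\{0,1\}^{\mathbb N}$ determined by $\pi$ and $P$, i.e. the Borel probability measure with $$\mu(\{x: x_1=a_1,\dots,x_k=a_k\})=\pi(a_1)P_{a_1,a_2}\cdots P_{a_{k-1},a_k}$$ for all $k\ge 1$ and $a_1,\dots,a_k\in\{0,1\}$. Let $\mathcal R$ be the tail equivalence relation on $X$: $x\sim y$ if there is $N$ such that $x_i=y_i$ for all $i\ge N$. Krieger's type of $(\mathcal R,\mu)$ is defined as follows, for a countable Borel equivalence relation $\mathcal R$ that is $\mu$-nonsingular and $\mu$-ergodic, with $\mu$ non-atomic (this is part of each assertion about the type). Let $\Delta$ be the Radon–Nikodym cocycle, with values in the multiplicative group $\mathbb R_+^*$ of positive reals: $\Delta(x,\gamma x)=\frac{d(\mu\circ\gamma)}{d\mu}(x)$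 for a.e. $x$, for every Borel bijection $\gamma$ of $X$ whose graph lies in $\mathcal R$. A cocycle $c:\mathcal R\to G$ is ergodic if the relation $(x,g)\sim(y,c(x,y)g)$, $(x,y)\in\mathcal R$, on $X\times G$ is ergodic for the product of $\mu$ and Haar measure. $\mathcal R$ is of type $II$ (respectively $II_1$) if there is a $\sigma$-finite (respectively finite) $\mathcal R$-invariant measure equivalent to $\mu$, and of type $III$ if it is not of type $II$. A relation of type $III$ is of type $III_1$ if $\Delta$ is ergodic; it is of type $III_\lambda$, for $\lambda\in(0,1)$, if $\Delta$ is cohomologous to a cocycle with values in $\{\lambda^n: n\in\mathbb Z\}$ that is ergodic as a cocycle with values in this group. Then: (i) $\mathcal R$ is of type $II_1$ if and only if $\alpha=\beta=1$. (ii) For each $\lambda\in(0,1)$, $\mathcal R$ is of type $III_\lambda$ if and only if there are integers $p,q\in\mathbb Z$ with $p\mathbb Z+q\mathbb Z=\mathbb Z$ such that $\alpha$ is the positive root of the quadratic equation $$\alpha^2+(1-\lambda^p)\alpha-\lambda^q=0\qquad\text{and}\qquad \beta=\lambda^{q-p}/\alpha .$$ (iii) If $\mathcal R$ is neither of type $II_1$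 nor of type $III_\lambda$ for any $\lambda\in(0,1)$, then $\mathcal R$ is of type $III_1$. -/

import Mathlib

open MeasureTheory ProbabilityTheory
open scoped ENNReal

noncomputable section

/-! ### Markov measures on `{0,1}^ℕ` -/

/-- An initial distribution on `{0,1}` together with a sequence of stochastic `2 × 2` matrices. -/
structure MarkovData where
  init : Fin 2 → ℝ
  trans : ℕ → Matrix (Fin 2) (Fin 2) ℝ
  init_nonneg : ∀ a, 0 ≤ init a
  init_sum : ∑ a, init a = 1
  trans_nonneg : ∀ n a b, 0 ≤ trans n a b
  trans_sum : ∀ n a, ∑ b, trans n a b = 1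

/-- The measure on `{0,1}` with weights `w 0`, `w 1`. -/
def weightMeasure (w : Fin 2 → ℝ) : Measure (Fin 2) :=
  ∑ a, ENNReal.ofReal (w a) • Measure.dirac a

theorem weightMeasure_singleton (w : Fin 2 → ℝ) (a : Fin 2) :
    weightMeasure w {a} = ENNReal.ofReal (w a) := by
  fin_cases a <;> simp [weightMeasure]

theorem isProbabilityMeasure_weightMeasure {w : Fin 2 → ℝ} (h0 : ∀ a, 0 ≤ w a)
    (h1 : ∑ a, w a = 1) : IsProbabilityMeasure (weightMeasure w) := by
  refine ⟨?_⟩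
  have h : weightMeasure w Set.univ = ∑ a, ENNReal.ofReal (w a) := by
    simp [weightMeasure]
  rw [h, ← ENNReal.ofReal_sum_of_nonneg (fun a _ => h0 a), h1, ENNReal.ofReal_one]

namespace MarkovData

/-- The transition from the coordinates `x 0, …, x n` to the coordinate `x (n + 1)`: its law is the
row of `trans n` with index `x n`. -/
def step (D : MarkovData) (n : ℕ) : Kernel (Finset.Iic n → Fin 2) (Fin 2) :=
  (Kernel.ofFunOfCountable fun a => weightMeasure (D.trans n a)).comap
    (fun x => x ⟨n, Finset.mem_Iic.2 le_rfl⟩) (measurable_pi_apply _)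

theorem step_apply (D : MarkovData) (n : ℕ) (x : Finset.Iic n → Fin 2) :
    D.step n x = weightMeasure (D.trans n (x ⟨n, Finset.mem_Iic.2 le_rfl⟩)) := rfl

instance (D : MarkovData) (n : ℕ) : IsMarkovKernel (D.step n) :=
  ⟨fun x => by
    rw [step_apply]
    exact isProbabilityMeasure_weightMeasure (D.trans_nonneg n _) (D.trans_sum n _)⟩

/-- The law of the coordinate `x 0`, on sequences of length one. -/
def initMeasure (D : MarkovData) : Measure (Finset.Iic 0 → Fin 2) :=
  (weightMeasure D.init).map fun a _ => a

/-- The Markov measure on `{0,1}^ℕ` determined by the initial distribution `D.init` and the matrices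
`D.trans n`. The coordinates are indexed from `0` on, and `D.trans n` governs the transition from
`x n` to `x (n + 1)`. -/
def measure (D : MarkovData) : Measure (ℕ → Fin 2) :=
  D.initMeasure.bind (Kernel.traj (X := fun _ => Fin 2) D.step 0)

instance (D : MarkovData) : IsProbabilityMeasure D.initMeasure := by
  have := isProbabilityMeasure_weightMeasure D.init_nonneg D.init_sum
  exact Measure.isProbabilityMeasure_map (by fun_prop)

instance (D : MarkovData) : IsProbabilityMeasure D.measure := by
  unfold measure
  infer_instance

theorem measure_cylinder (D : MarkovData) (a : ℕ → Fin 2) (k : ℕ) :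
    D.measure {x | ∀ i ≤ k, x i = a i} =
      ENNReal.ofReal (D.init (a 0) * ∏ i ∈ Finset.range k, D.trans i (a i) (a (i + 1))) := by
  have hmap : ∀ b, D.measure.map (Preorder.frestrictLe b) =
      D.initMeasure.bind (Kernel.partialTraj (X := fun _ => Fin 2) D.step 0 b) := by
    intro b
    rw [← Kernel.traj_map_frestrictLe, measure, Measure.map_comp _ _ (by fun_prop)]
  have hset : ∀ b, D.measure {x | ∀ i ≤ b, x i = a i} =
      D.measure.map (Preorder.frestrictLe b) {fun i : Finset.Iic b => a i} := by
    intro b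
    rw [Measure.map_apply (by fun_prop) (measurableSet_singleton _)]
    congr 1
    ext x
    simp [funext_iff, Preorder.frestrictLe]
  rw [hset]
  induction k with
  | zero =>
    rw [hmap, Kernel.partialTraj_self, Measure.id_comp, initMeasure,
      Measure.map_apply (by fun_prop) (measurableSet_singleton _)]
    have : (fun (c : Fin 2) (_ : Finset.Iic 0) => c) ⁻¹'
        {fun i : Finset.Iic 0 => a i} = {a 0} := by
      ext c
      simp [funext_iff]
    rw [this, weightMeasure_singleton]
    simp
  | succ k ih =>
    have hstep : ∀ y : Finset.Iic k → Fin 2,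
        Kernel.partialTraj (X := fun _ => Fin 2) D.step k (k + 1) y
            {fun i : Finset.Iic (k + 1) => a i} =
          Set.indicator {fun i : Finset.Iic k => a i}
            (fun _ => ENNReal.ofReal (D.trans k (a k) (a (k + 1)))) y := by
      intro y
      have hpre : (IicProdIoc (X := fun _ => Fin 2) k (k + 1)) ⁻¹'
          {fun i : Finset.Iic (k + 1) => a i} =
          {fun i : Finset.Iic k => a i} ×ˢ
            ((MeasurableEquiv.piSingleton (X := fun _ => Fin 2) k).symm ⁻¹' {a (k + 1)}) := by
        ext ⟨u, v⟩
        simp only [Set.mem_preimage, Set.mem_singleton_iff, Set.mem_prod]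
        constructor
        · intro h
          refine ⟨funext fun i => ?_, ?_⟩
          · have hi : (i : ℕ) ≤ k := Finset.mem_Iic.1 i.2
            have := congrFun h ⟨i, Finset.mem_Iic.2 (hi.trans (Nat.le_succ k))⟩
            simpa [IicProdIoc, hi] using this
          · have := congrFun h ⟨k + 1, Finset.mem_Iic.2 le_rfl⟩
            have h2 : v ⟨k + 1, Finset.right_mem_Ioc.2 k.lt_succ_self⟩ = a (k + 1) := by
              simpa [IicProdIoc] using this
            exact h2
        · rintro ⟨rfl, h⟩
          funext ⟨i, hi⟩
          by_cases hik : i ≤ k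
          · simp [IicProdIoc, hik]
          · obtain rfl : i = k + 1 := le_antisymm (Finset.mem_Iic.1 hi) (by omega)
            have h2 : v ⟨k + 1, Finset.right_mem_Ioc.2 k.lt_succ_self⟩ = a (k + 1) := h
            simpa [IicProdIoc] using h2
      rw [Kernel.partialTraj_succ_self, Kernel.map_apply' _ (by fun_prop) _
        (measurableSet_singleton _), hpre, Kernel.prod_apply_prod, Kernel.map_apply' _ (by fun_prop) _
        (MeasurableEquiv.measurable _ (measurableSet_singleton _))]
      have hid : (MeasurableEquiv.piSingleton (X := fun _ => Fin 2) k) ⁻¹'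
          ((MeasurableEquiv.piSingleton (X := fun _ => Fin 2) k).symm ⁻¹' {a (k + 1)}) =
          {a (k + 1)} := by
        ext c
        simp
      rw [hid, step_apply, weightMeasure_singleton, Kernel.id_apply,
        Measure.dirac_apply' _ (measurableSet_singleton _)]
      by_cases hy : y = fun i : Finset.Iic k => a i
      · subst hy
        simp
      · simp [hy]
    rw [hmap, Kernel.partialTraj_succ_eq_comp (Nat.zero_le k), ← Measure.comp_assoc, ← hmap,
      Measure.bind_apply (measurableSet_singleton _) (by fun_prop)]
    simp_rw [hstep]
    rw [lintegral_indicator (measurableSet_singleton _), lintegral_const,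
      Measure.restrict_apply_univ, ih, mul_comm, ← ENNReal.ofReal_mul, Finset.prod_range_succ,
      mul_assoc]
    exact mul_nonneg (D.init_nonneg _) (Finset.prod_nonneg fun i _ => D.trans_nonneg i _ _)

end MarkovData

/-! ### Measured equivalence relations, cocycles and Krieger's types -/

/-- The tail equivalence relation on `{0,1}^ℕ`. -/
def TailRel (x y : ℕ → Fin 2) : Prop := ∃ N, ∀ i ≥ N, x i = y i

/-- The multiplicative group of positive real numbers, with its usual topology. -/
abbrev PosReal := {x : ℝ // 0 < x}

section Relation

variable {X : Type*} [MeasurableSpace X]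

/-- Every measurable set that is saturated for `r` is null or conull. -/
def IsErgodicRel (r : X → X → Prop) (μ : Measure X) : Prop :=
  ∀ A : Set X, MeasurableSet A → (∀ x y, r x y → (x ∈ A ↔ y ∈ A)) → μ A = 0 ∨ μ Aᶜ = 0

/-- A countable Borel equivalence relation, nonsingular and ergodic for a non-atomic `σ`-finite
measure: the objects to which Krieger's types are attached. -/
structure IsErgodicNonsingular (r : X → X → Prop) (μ : Measure X) : Prop where
  equivalence : Equivalence r
  measurableSet : MeasurableSet {p : X × X | r p.1 p.2}
  countable : ∀ x, {y | r x y}.Countable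
  sigmaFinite : SigmaFinite μ
  noAtoms : NullSingletonClass μ
  nonsingular : ∀ A : Set X, MeasurableSet A → μ A = 0 → μ {y | ∃ x ∈ A, r x y} = 0
  ergodic : IsErgodicRel r μ

/-- `ν` is invariant under every Borel automorphism that moves points inside their classes. -/
def IsInvariantMeasure (r : X → X → Prop) (ν : Measure X) : Prop :=
  ∀ γ : X ≃ᵐ X, (∀ x, r x (γ x)) → ν.map γ = ν

/-- A Borel map `a` on the relation (only the values `a x y` with `r x y` matter) that satisfies the
cocycle identity on a conull set. -/
structure IsCocycle {G : Type*} [Group G] [MeasurableSpace G] (r : X → X → Prop) (μ : Measure X)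
    (a : X → X → G) : Prop where
  measurable : Measurable fun p : {p : X × X // r p.1 p.2} => a p.1.1 p.1.2
  identity : ∃ A : Set X, μ Aᶜ = 0 ∧ ∀ x ∈ A, ∀ y ∈ A, ∀ z ∈ A, r x y → r y z →
    a x y * a y z = a x z

/-- `a` and `b` are cohomologous: `a x y = φ(x)⁻¹ b x y φ(y)` for a Borel map `φ`, on the restriction
of the relation to a conull set. -/
def Cohomologous {G : Type*} [Group G] [MeasurableSpace G] (r : X → X → Prop) (μ : Measure X)
    (a b : X → X → G) : Prop :=
  ∃ φ : X → G, Measurable φ ∧ ∃ A : Set X, μ Aᶜ = 0 ∧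
    ∀ x ∈ A, ∀ y ∈ A, r x y → a x y = (φ x)⁻¹ * b x y * φ y

/-- The skew product of the relation `r` with the map `a`. -/
def SkewProduct {G : Type*} [Group G] (r : X → X → Prop) (a : X → X → G) (p q : X × G) : Prop :=
  r p.1 q.1 ∧ q.2 = a p.1 q.1 * p.2

/-- A cocycle is ergodic if its skew product is ergodic for the product of `μ` and a (left) Haar
measure. -/
def IsErgodicCocycle {G : Type*} [Group G] [TopologicalSpace G] [MeasurableSpace G]
    (r : X → X → Prop) (μ : Measure X) (a : X → X → G) : Prop :=
  ∃ η : Measure G, η.IsHaarMeasure ∧ SigmaFinite η ∧ IsErgodicRel (SkewProduct r a) (μ.prod η)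

/-- `Δ` is the Radon-Nikodym cocycle of `(r, μ)`: for every Borel automorphism `γ` that moves points
inside their classes, `Δ x (γ x) = (d(μ ∘ γ)/dμ) x` for almost every `x`. Here `μ ∘ γ` is the measure
`A ↦ μ (γ '' A)`, that is, the push-forward of `μ` under `γ⁻¹`. -/
structure IsRadonNikodymCocycle (r : X → X → Prop) (μ : Measure X) (Δ : X → X → PosReal) :
    Prop where
  isCocycle : IsCocycle r μ Δ
  eq_rnDeriv : ∀ γ : X ≃ᵐ X, (∀ x, r x (γ x)) →
    ∀ᵐ x ∂μ, ENNReal.ofReal (Δ x (γ x) : ℝ) = (μ.map γ.symm).rnDeriv μ x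

/-- Type `II`: there is an equivalent `σ`-finite invariant measure. -/
def IsTypeII (r : X → X → Prop) (μ : Measure X) : Prop :=
  IsErgodicNonsingular r μ ∧
    ∃ ν : Measure X, SigmaFinite ν ∧ ν ≪ μ ∧ μ ≪ ν ∧ IsInvariantMeasure r ν

/-- Type `II₁`: there is an equivalent finite invariant measure. -/
def IsTypeIIOne (r : X → X → Prop) (μ : Measure X) : Prop :=
  IsErgodicNonsingular r μ ∧
    ∃ ν : Measure X, IsFiniteMeasure ν ∧ ν ≪ μ ∧ μ ≪ ν ∧ IsInvariantMeasure r ν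

/-- Type `III`: not of type `II`. -/
def IsTypeIII (r : X → X → Prop) (μ : Measure X) : Prop :=
  IsErgodicNonsingular r μ ∧ ¬ IsTypeII r μ

/-- Type `III_l`, `0 < l < 1`: the Radon-Nikodym cocycle is cohomologous to a cocycle with values in
the group of the integer powers of `l` that is ergodic as a cocycle with values in this group. -/
def IsTypeIIILambda (r : X → X → Prop) (μ : Measure X) (l : PosReal) : Prop :=
  IsTypeIII r μ ∧ (l : ℝ) < 1 ∧
    ∃ Δ : X → X → PosReal, IsRadonNikodymCocycle r μ Δ ∧
      ∃ b : X → X → Subgroup.zpowers l, IsCocycle r μ b ∧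
        Cohomologous r μ Δ (fun x y => (b x y : PosReal)) ∧ IsErgodicCocycle r μ b

/-- Type `III₁`: the Radon-Nikodym cocycle is ergodic. -/
def IsTypeIIIOne (r : X → X → Prop) (μ : Measure X) : Prop :=
  IsTypeIII r μ ∧
    ∃ Δ : X → X → PosReal, IsRadonNikodymCocycle r μ Δ ∧ IsErgodicCocycle r μ Δ

end Relation

end

/-! Put `r = (1+α)/(1+β)` and `s = αβ`. Conjugating `P` by `diag(1, α)` turns its entries, up to the
common factor `1/(1+α)`, into `1` for a transition out of `0`, `r` for `1 → 1` and `r * s` for `1 →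
0`. The Radon-Nikodym cocycle of the tail relation is therefore `φ(x)⁻¹ r^m s^n φ(y)`, where `φ`
depends on `x 0` only and `(m, n)` is the change in the numbers of ones and of transitions `1 → 0`.

The key fact (`isInvariantFamily_zero_one`) is that this `ℤ × ℤ`-valued counting cocycle is itself
ergodic. A set of positive measure nearly fills a cylinder, and hence its bounded extensions;
changing one letter after the cylinder alters the count by `(1, 0)` or `(1, 1)`, which generate `ℤ ×
ℤ`, and rescales the measure there by a constant.

The type then depends only on the subgroup of the positive reals generated by `r` and `s`. If it is
trivial, `φ⁻¹ μ` is a finite invariant measure. If it is generated by `l < 1`, the cocycle is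
cohomologous to an ergodic one with values in the powers of `l`. If it is dense, the cocycle is
ergodic, since a Borel set invariant under dense translations is null or conull. Conversely,
`exists_const_of_mem_subgroup` shows that a cocycle cohomologous to one with values in a suitable
closed subgroup forces `r` and `s` into it; this excludes type II when `(r, s) ≠ (1, 1)` and
determines `l`. A subgroup of the reals is dense or cyclic, so no case is left, and the equations in
`α`, `β` express `r = l^p`, `s = l^(q-p)`. -/

/-! ### Cylinders in `{0,1}^ℕ` -/

/-- The sequences that agree with `a` up to the index `n`. -/
def Cyl (n : ℕ) (a : ℕ → Fin 2) : Set (ℕ → Fin 2) := {x | ∀ i ≤ n, x i = a i}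

theorem measurableSet_cyl (n : ℕ) (a : ℕ → Fin 2) : MeasurableSet (Cyl n a) := by
  have : Cyl n a = ⋂ i, ⋂ (_ : i ≤ n), (fun x : ℕ → Fin 2 => x i) ⁻¹' {a i} := by
    ext x
    simp [Cyl]
  rw [this]
  exact MeasurableSet.iInter fun i => MeasurableSet.iInter fun _ =>
    measurable_pi_apply i (measurableSet_singleton _)

theorem mem_cyl_self (n : ℕ) (a : ℕ → Fin 2) : a ∈ Cyl n a := fun _ _ => rfl

theorem cyl_congr {n : ℕ} {a b : ℕ → Fin 2} (h : ∀ i ≤ n, a i = b i) : Cyl n a = Cyl n b := by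
  ext x
  exact forall₂_congr fun i hi => by rw [h i hi]

theorem cyl_eq_preimage (n : ℕ) (a : ℕ → Fin 2) :
    Cyl n a = (Preorder.frestrictLe (π := fun _ => Fin 2) n) ⁻¹' {fun i : Finset.Iic n => a i} := by
  ext x
  simp [Cyl, funext_iff, Preorder.frestrictLe]

theorem preimage_frestrictLe_singleton (n : ℕ) (u : Finset.Iic n → Fin 2) :
    (Preorder.frestrictLe (π := fun _ => Fin 2) n) ⁻¹' {u} =
      Cyl n fun i => if h : i ≤ n then u ⟨i, Finset.mem_Iic.2 h⟩ else 0 := by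
  rw [cyl_eq_preimage]
  congr 2
  funext i
  simp [Finset.mem_Iic.1 i.2]

theorem cylinder_Iic_mono {m n : ℕ} (h : m ≤ n) (S : Set (Finset.Iic m → Fin 2)) :
    ∃ S' : Set (Finset.Iic n → Fin 2), cylinder (α := fun _ => Fin 2) (Finset.Iic m) S =
      Preorder.frestrictLe (π := fun _ => Fin 2) n ⁻¹' S' :=
  ⟨(fun (u : Finset.Iic n → Fin 2) (i : Finset.Iic m) => u ⟨i, Finset.mem_Iic.2 ((Finset.mem_Iic.1 i.2).trans h)⟩) ⁻¹' S, rfl⟩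

theorem exists_level_of_mem_measurableCylinders {t : Set (ℕ → Fin 2)}
    (ht : t ∈ measurableCylinders fun _ : ℕ => Fin 2) :
    ∃ N, ∀ n ≥ N, ∃ S : Set (Finset.Iic n → Fin 2),
      t = Preorder.frestrictLe (π := fun _ => Fin 2) n ⁻¹' S := by
  rw [measurableCylinders_nat] at ht
  simp only [Set.mem_iUnion, Set.mem_singleton_iff] at ht
  obtain ⟨N, S, -, rfl⟩ := ht
  exact ⟨N, fun n hn => cylinder_Iic_mono hn S⟩

/-- A set determined by finitely many coordinates is a finite disjoint union of cylinders. The form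
with `≤` also serves to compare `ε • μ` with a restriction of `μ`. -/
theorem measure_le_of_cyl {μ ν : Measure (ℕ → Fin 2)} {n : ℕ}
    (h : ∀ a, μ (Cyl n a) ≤ ν (Cyl n a)) (S : Set (Finset.Iic n → Fin 2)) :
    μ (Preorder.frestrictLe (π := fun _ => Fin 2) n ⁻¹' S) ≤
      ν (Preorder.frestrictLe (π := fun _ => Fin 2) n ⁻¹' S) := by
  have key : ∀ ρ : Measure (ℕ → Fin 2), ρ (Preorder.frestrictLe (π := fun _ => Fin 2) n ⁻¹' S) =
      ∑' u : S, ρ (Preorder.frestrictLe (π := fun _ => Fin 2) n ⁻¹' {u.1}) := by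
    intro ρ
    refine (tsum_measure_preimage_singleton (Set.to_countable S) fun u _ => ?_).symm
    rw [preimage_frestrictLe_singleton]
    exact measurableSet_cyl _ _
  rw [key, key]
  refine ENNReal.tsum_le_tsum fun u => ?_
  rw [preimage_frestrictLe_singleton]
  exact h _

theorem measure_ext_of_cyl {μ ν : Measure (ℕ → Fin 2)} [IsFiniteMeasure μ] (N : ℕ)
    (h : ∀ n ≥ N, ∀ a, μ (Cyl n a) = ν (Cyl n a)) : μ = ν := by
  have key : ∀ t ∈ measurableCylinders fun _ : ℕ => Fin 2, μ t = ν t := by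
    intro t ht
    obtain ⟨M, hM⟩ := exists_level_of_mem_measurableCylinders ht
    obtain ⟨S, rfl⟩ := hM (max M N) (le_max_left _ _)
    exact le_antisymm (measure_le_of_cyl (fun a => (h _ (le_max_right _ _) a).le) S)
      (measure_le_of_cyl (fun a => (h _ (le_max_right _ _) a).ge) S)
  exact ext_of_generate_finite _ generateFrom_measurableCylinders.symm
    isPiSystem_measurableCylinders key (key _ (univ_mem_measurableCylinders _))

/-- A set of positive measure nearly fills some cylinder of each large length. -/
theorem exists_cyl_measure_diff_lt (μ : Measure (ℕ → Fin 2)) [IsFiniteMeasure μ]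
    {D : Set (ℕ → Fin 2)} (hD : MeasurableSet D) (hμ : μ D ≠ 0) {ε : ℝ≥0∞} (hε : ε ≠ 0)
    (hε1 : ε ≤ 1) : ∃ N, ∀ n ≥ N, ∃ a, μ (Cyl n a \ D) < ε * μ (Cyl n a) := by
  have hne : ε ≠ ∞ := ne_top_of_le_ne_top ENNReal.one_ne_top hε1
  -- If every cylinder failed, summing over those that make up an approximant `t` would give `ε * μ
  -- t ≤ μ (t \ D)`. With error `ε * μ D / 4` this yields `ε * μ D ≤ ε * μ D / 2`.
  have hδ : ε * μ D / 4 ≠ 0 := by simp [hε, hμ]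
  obtain ⟨t, ht, htD⟩ := exists_measure_symmDiff_lt_of_generateFrom_isSetRing
    (μ := μ) isSetRing_measurableCylinders ⟨{Set.univ}, Set.countable_singleton _,
      by simpa using univ_mem_measurableCylinders fun _ : ℕ => Fin 2, by simp⟩
    generateFrom_measurableCylinders.symm hD (pos_iff_ne_zero.2 hδ)
  obtain ⟨N, hN⟩ := exists_level_of_mem_measurableCylinders ht
  refine ⟨N, fun n hn => ?_⟩
  by_contra! hcon
  obtain ⟨S, hS⟩ := hN n hn
  have hle : ε * μ t ≤ μ (t \ D) := by
    have := measure_le_of_cyl (μ := ε • μ) (ν := μ.restrict Dᶜ) (n := n) (fun a => by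
      rw [Measure.smul_apply, smul_eq_mul, Measure.restrict_apply (measurableSet_cyl _ _)]
      exact hcon a) S
    rwa [← hS, Measure.smul_apply, smul_eq_mul,
      Measure.restrict_apply (MeasurableSet.of_mem_measurableCylinders ht)] at this
  have h1 : μ (t \ D) ≤ ε * μ D / 4 :=
    (measure_mono (Set.subset_union_left)).trans htD.le
  have h2 : μ D ≤ μ t + ε * μ D / 4 := by
    refine (measure_mono (t := t ∪ symmDiff t D) fun x hx => ?_).trans
      ((measure_union_le _ _).trans (by gcongr))
    by_cases hxt : x ∈ t
    · exact Or.inl hxt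
    · exact Or.inr (Or.inr ⟨hx, hxt⟩)
  have h3 : ε * μ D ≤ ε * μ D / 4 + ε * μ D / 4 := calc
    ε * μ D ≤ ε * (μ t + ε * μ D / 4) := by gcongr
    _ = ε * μ t + ε * (ε * μ D / 4) := mul_add _ _ _
    _ ≤ ε * μ D / 4 + 1 * (ε * μ D / 4) := by gcongr; exact hle.trans h1
    _ = _ := by rw [one_mul]
  have hfin : ε * μ D ≠ ∞ := ENNReal.mul_ne_top hne (measure_ne_top _ _)
  have hz : ε * μ D ≠ 0 := mul_ne_zero hε hμ
  have hpos : 0 < (ε * μ D).toReal := ENNReal.toReal_pos hz hfin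
  have h4 : ε * μ D / 4 ≠ ∞ := ENNReal.div_ne_top hfin (by norm_num)
  have h5 := ENNReal.toReal_mono (ENNReal.add_ne_top.2 ⟨h4, h4⟩) h3
  rw [ENNReal.toReal_add h4 h4, ENNReal.toReal_div, ENNReal.toReal_ofNat] at h5
  linarith

/-! ### Translation by finitely supported sequences -/

/-- The translation by a finitely supported sequence. -/
noncomputable def shiftBy (h : ℕ →₀ Fin 2) : (ℕ → Fin 2) ≃ᵐ (ℕ → Fin 2) :=
  MeasurableEquiv.addRight (h : ℕ → Fin 2)

theorem shiftBy_apply (h : ℕ →₀ Fin 2) (x : ℕ → Fin 2) : shiftBy h x = x + h := rfl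

theorem shiftBy_neg_apply_shiftBy (h : ℕ →₀ Fin 2) (x : ℕ → Fin 2) :
    shiftBy (-h) (shiftBy h x) = x := by
  simp [shiftBy_apply]

theorem shiftBy_symm (h : ℕ →₀ Fin 2) : (shiftBy h).symm = shiftBy (-h) := by
  ext x : 2
  rw [MeasurableEquiv.symm_apply_eq]
  simp [shiftBy_apply]

theorem exists_support_bound (h : ℕ →₀ Fin 2) : ∃ N, ∀ i ≥ N, h i = 0 := by
  refine ⟨h.support.sup id + 1, fun i hi => ?_⟩
  by_contra hne
  have := Finset.le_sup (f := id) (Finsupp.mem_support_iff.2 hne)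
  simp only [id] at this
  omega

theorem shiftBy_mem_cyl_iff (h : ℕ →₀ Fin 2) (n : ℕ) (a x : ℕ → Fin 2) :
    shiftBy h x ∈ Cyl n (shiftBy h a) ↔ x ∈ Cyl n a := by
  simp [Cyl, shiftBy_apply]

theorem tailRel_shiftBy (h : ℕ →₀ Fin 2) (x : ℕ → Fin 2) : TailRel x (shiftBy h x) := by
  obtain ⟨N, hN⟩ := exists_support_bound h
  exact ⟨N, fun i hi => by simp [shiftBy_apply, hN i hi]⟩

/-- The difference of two sequences, cut off at `n`. -/
noncomputable def diffBelow (n : ℕ) (x y : ℕ → Fin 2) : ℕ →₀ Fin 2 :=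
  Finsupp.onFinset (Finset.range n) (fun i => if i < n then y i - x i else 0) (by simp; tauto)

theorem shiftBy_diffBelow {n : ℕ} {x y : ℕ → Fin 2} (h : ∀ i ≥ n, x i = y i) :
    shiftBy (diffBelow n x y) x = y := by
  funext i
  by_cases hi : i < n
  · simp [shiftBy_apply, diffBelow, hi]
  · simp [shiftBy_apply, diffBelow, hi, h i (not_lt.1 hi)]

theorem diffBelow_eq_zero {n : ℕ} {x y : ℕ → Fin 2} {i : ℕ} (hi : n ≤ i) :
    diffBelow n x y i = 0 := by
  simp [diffBelow, hi]

/-- The tail classes are the orbits of a countable group, so statements almost everywhere can be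
checked one translation at a time. -/
theorem tailRel_iff_exists_shiftBy {x y : ℕ → Fin 2} : TailRel x y ↔ ∃ h, shiftBy h x = y :=
  ⟨fun ⟨n, hn⟩ => ⟨diffBelow n x y, shiftBy_diffBelow hn⟩,
    fun ⟨h, hh⟩ => hh ▸ tailRel_shiftBy h x⟩

theorem tailRel_equivalence : Equivalence TailRel where
  refl _ := ⟨0, fun _ _ => rfl⟩
  symm := fun ⟨N, h⟩ => ⟨N, fun i hi => (h i hi).symm⟩
  trans := fun ⟨N, h⟩ ⟨M, k⟩ => ⟨max N M, fun i hi =>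
    (h i (le_trans (le_max_left _ _) hi)).trans (k i (le_trans (le_max_right _ _) hi))⟩

theorem measurableSet_agree_from (N : ℕ) :
    MeasurableSet {p : (ℕ → Fin 2) × (ℕ → Fin 2) | ∀ i ≥ N, p.1 i = p.2 i} := by
  have : {p : (ℕ → Fin 2) × (ℕ → Fin 2) | ∀ i ≥ N, p.1 i = p.2 i} =
      ⋂ i, ⋂ (_ : i ≥ N), {p | p.1 i = p.2 i} := by
    ext p
    simp
  rw [this]
  exact MeasurableSet.iInter fun i => MeasurableSet.iInter fun _ =>
    measurableSet_eq_fun (by fun_prop) (by fun_prop)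

theorem measurableSet_tailRel :
    MeasurableSet {p : (ℕ → Fin 2) × (ℕ → Fin 2) | TailRel p.1 p.2} := by
  have : {p : (ℕ → Fin 2) × (ℕ → Fin 2) | TailRel p.1 p.2} =
      ⋃ N, {p | ∀ i ≥ N, p.1 i = p.2 i} := by
    ext p
    simp [TailRel]
  rw [this]
  exact MeasurableSet.iUnion measurableSet_agree_from

theorem countable_tailRel (x : ℕ → Fin 2) : {y | TailRel x y}.Countable := by
  have : {y | TailRel x y} = Set.range fun h => shiftBy h x := by
    ext y
    exact tailRel_iff_exists_shiftBy
  rw [this]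
  exact Set.countable_range _

/-! ### The counting cocycle of the tail relation -/

/-- The indicators of `a = 1` and of the transition from `1` to `0`. -/
def transitionCount (a b : Fin 2) : ℤ × ℤ :=
  (if a = 1 then 1 else 0, if a = 1 ∧ b = 0 then 1 else 0)

/-- The numbers of ones and of transitions from `1` to `0` before the index `n`. -/
def pathCount (n : ℕ) (x : ℕ → Fin 2) : ℤ × ℤ :=
  ∑ i ∈ Finset.range n, transitionCount (x i) (x (i + 1))

theorem pathCount_congr {n : ℕ} {x y : ℕ → Fin 2} (h : ∀ i ≤ n, x i = y i) :
    pathCount n x = pathCount n y :=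
  Finset.sum_congr rfl fun i hi => by
    have := Finset.mem_range.1 hi
    rw [h i (by omega), h (i + 1) (by omega)]

/-- From `m` on both sequences make the same transitions, so the difference of counts does not
depend on the cutoff. -/
theorem pathCount_sub_eq {m n : ℕ} (hmn : m ≤ n) {x y : ℕ → Fin 2} (h : ∀ i ≥ m, x i = y i) :
    pathCount n y - pathCount n x = pathCount m y - pathCount m x := by
  induction n, hmn using Nat.le_induction with
  | base => rfl
  | succ n hn ih =>
    rw [← ih, pathCount, pathCount, Finset.sum_range_succ, Finset.sum_range_succ, pathCount,
      pathCount, h n hn, h (n + 1) (by omega)]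
    abel

open Classical in
/-- The least index from which on two tail equivalent sequences agree. -/
noncomputable def agreeIndex (x y : ℕ → Fin 2) : ℕ :=
  if h : TailRel x y then Nat.find h else 0

theorem agreeIndex_spec {x y : ℕ → Fin 2} (h : TailRel x y) : ∀ i ≥ agreeIndex x y, x i = y i := by
  classical
  rw [agreeIndex, dif_pos h]
  exact Nat.find_spec h

/-- The cocycle on the tail relation that counts ones and transitions from `1` to `0`. -/
noncomputable def countCocycle (x y : ℕ → Fin 2) : ℤ × ℤ :=
  pathCount (agreeIndex x y) y - pathCount (agreeIndex x y) x

theorem countCocycle_eq {n : ℕ} {x y : ℕ → Fin 2} (h : ∀ i ≥ n, x i = y i) :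
    countCocycle x y = pathCount n y - pathCount n x := by
  have hxy : TailRel x y := ⟨n, h⟩
  rw [countCocycle, ← pathCount_sub_eq (le_max_left (agreeIndex x y) n) (agreeIndex_spec hxy),
    ← pathCount_sub_eq (le_max_right (agreeIndex x y) n) h]

theorem countCocycle_add {x y z : ℕ → Fin 2} (h : TailRel x y) (k : TailRel y z) :
    countCocycle x y + countCocycle y z = countCocycle x z := by
  obtain ⟨N, hN⟩ := h
  obtain ⟨M, hM⟩ := k
  have h1 : ∀ i ≥ max N M, x i = y i := fun i hi => hN i (le_trans (le_max_left _ _) hi)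
  have h2 : ∀ i ≥ max N M, y i = z i := fun i hi => hM i (le_trans (le_max_right _ _) hi)
  rw [countCocycle_eq h1, countCocycle_eq h2,
    countCocycle_eq fun i hi => (h1 i hi).trans (h2 i hi)]
  abel

theorem measurable_pathCount (n : ℕ) : Measurable (pathCount n) :=
  Finset.measurable_sum _ fun i _ =>
    (measurable_of_countable fun p : Fin 2 × Fin 2 => transitionCount p.1 p.2).comp
      ((measurable_pi_apply (X := fun _ => Fin 2) i).prodMk (measurable_pi_apply (i + 1)))

theorem measurable_countCocycle :
    Measurable fun p : {p : (ℕ → Fin 2) × (ℕ → Fin 2) // TailRel p.1 p.2} =>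
      countCocycle p.1.1 p.1.2 := by
  classical
  have h1 : Measurable fun p : {p : (ℕ → Fin 2) × (ℕ → Fin 2) // TailRel p.1 p.2} =>
      agreeIndex p.1.1 p.1.2 := by
    have : (fun p : {p : (ℕ → Fin 2) × (ℕ → Fin 2) // TailRel p.1 p.2} =>
        agreeIndex p.1.1 p.1.2) = fun p => Nat.find p.2 := by
      funext p
      rw [agreeIndex, dif_pos p.2]
    rw [this]
    exact measurable_find (fun p : {p : (ℕ → Fin 2) × (ℕ → Fin 2) // TailRel p.1 p.2} => p.2)
      fun k => measurable_subtype_coe (measurableSet_agree_from k)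
  have h2 : Measurable fun q : ({p : (ℕ → Fin 2) × (ℕ → Fin 2) // TailRel p.1 p.2}) × ℕ =>
      pathCount q.2 q.1.1.2 - pathCount q.2 q.1.1.1 := by
    refine measurable_from_prod_countable_left fun n => ?_
    exact ((measurable_pathCount n).comp (measurable_snd.comp measurable_subtype_coe)).sub
      ((measurable_pathCount n).comp (measurable_fst.comp measurable_subtype_coe))
  exact h2.comp (measurable_id.prodMk h1)

/-! ### Multiplicative cocycles -/

section Group

variable {G : Type*} [CommGroup G]

/-- The homomorphism from `ℤ × ℤ` that sends the standard basis to `r`, `s`. -/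
def pairPow (r s : G) (g : ℤ × ℤ) : G := r ^ g.1 * s ^ g.2

theorem pairPow_add (r s : G) (g h : ℤ × ℤ) :
    pairPow r s (g + h) = pairPow r s g * pairPow r s h := by
  simp only [pairPow, Prod.fst_add, Prod.snd_add, zpow_add]
  exact mul_mul_mul_comm _ _ _ _

theorem pairPow_zero (r s : G) : pairPow r s 0 = 1 := by simp [pairPow]

theorem pairPow_zsmul (r s : G) (n : ℤ) (g : ℤ × ℤ) : pairPow r s (n • g) = pairPow r s g ^ n := by
  simp only [pairPow, Prod.smul_fst, Prod.smul_snd, smul_eq_mul, mul_zpow, ← zpow_mul]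
  rw [mul_comm n, mul_comm n]

/-- Serves with `a, b` the values of one transfer function at `x, y`, and `a', b'` those of another:
passing to `y` in the skew product then only multiplies by `k`. -/
theorem mul_coboundary_cancel (a a' b b' c t k : G) :
    b * b'⁻¹ * c * (a * (a'⁻¹ * k * b') * b⁻¹ * t) = a * a'⁻¹ * c * t * k := by
  calc _ = b * b⁻¹ * (b' * b'⁻¹) * (a * a'⁻¹ * c * t * k) := by
        simp only [mul_comm, mul_left_comm, mul_assoc]
    _ = _ := by rw [mul_inv_cancel, mul_inv_cancel, one_mul, one_mul]

/-- The cocycle `φ(x)⁻¹ r ^ m s ^ n φ(y)`, where `(m, n)` is the value at `(x, y)` of the counting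
cocycle. -/
noncomputable def twistedCocycle (φ : (ℕ → Fin 2) → G) (r s : G) (x y : ℕ → Fin 2) : G :=
  (φ x)⁻¹ * pairPow r s (countCocycle x y) * φ y

theorem twistedCocycle_mul (φ : (ℕ → Fin 2) → G) (r s : G) {x y z : ℕ → Fin 2}
    (h : TailRel x y) (k : TailRel y z) :
    twistedCocycle φ r s x y * twistedCocycle φ r s y z = twistedCocycle φ r s x z := by
  simp only [twistedCocycle]
  rw [← countCocycle_add h k, pairPow_add]
  group

theorem isCocycle_twistedCocycle [MeasurableSpace G] [MeasurableMul₂ G] [MeasurableInv G]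
    {φ : (ℕ → Fin 2) → G} (hφ : Measurable φ) (r s : G) (μ : Measure (ℕ → Fin 2)) :
    IsCocycle TailRel μ (twistedCocycle φ r s) where
  measurable :=
    (((hφ.comp (measurable_fst.comp measurable_subtype_coe)).inv).mul
      ((measurable_of_countable (pairPow r s)).comp measurable_countCocycle)).mul
      (hφ.comp (measurable_snd.comp measurable_subtype_coe))
  identity := ⟨Set.univ, by simp, fun _ _ _ _ _ _ h k => twistedCocycle_mul φ r s h k⟩

end Group

theorem IsCocycle.measurable_apply {X G : Type*} [MeasurableSpace X] [Group G] [MeasurableSpace G]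
    {r : X → X → Prop} {μ : Measure X} {a : X → X → G} (ha : IsCocycle r μ a) {f : X → X}
    (hf : Measurable f) (hr : ∀ x, r x (f x)) : Measurable fun x => a x (f x) :=
  ha.measurable.comp ((measurable_id.prodMk hf).subtype_mk (h := hr))

/-! ### The group of positive reals -/

instance : IsTopologicalGroup PosReal where
  continuous_mul := Continuous.subtype_mk (by fun_prop) _
  continuous_inv := Continuous.subtype_mk
    (continuous_subtype_val.inv₀ fun x : PosReal => x.2.ne') _

instance : LocallyCompactSpace PosReal := (isOpen_Ioi (a := (0 : ℝ))).locallyCompactSpace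

/-! ### Weights of paths -/

namespace MarkovData

/-- The weight of the path `x 0, …, x n`. -/
noncomputable def weight (D : MarkovData) (n : ℕ) (x : ℕ → Fin 2) : ℝ :=
  D.init (x 0) * ∏ i ∈ Finset.range n, D.trans i (x i) (x (i + 1))

theorem measure_cyl (D : MarkovData) (n : ℕ) (a : ℕ → Fin 2) :
    D.measure (Cyl n a) = ENNReal.ofReal (D.weight n a) :=
  D.measure_cylinder a n

theorem weight_congr (D : MarkovData) {n : ℕ} {x y : ℕ → Fin 2} (h : ∀ i ≤ n, x i = y i) :
    D.weight n x = D.weight n y := by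
  rw [weight, weight, h 0 (Nat.zero_le _)]
  congr 1
  refine Finset.prod_congr rfl fun i hi => ?_
  have := Finset.mem_range.1 hi
  rw [h i (by omega), h (i + 1) (by omega)]

theorem weight_pos {D : MarkovData} (hinit : ∀ a, 0 < D.init a)
    (htrans : ∀ n a b, 0 < D.trans n a b) (n : ℕ) (x : ℕ → Fin 2) : 0 < D.weight n x :=
  mul_pos (hinit _) (Finset.prod_pos fun _ _ => htrans _ _ _)

theorem weight_succ (D : MarkovData) (n : ℕ) (x : ℕ → Fin 2) :
    D.weight (n + 1) x = D.weight n x * D.trans n (x n) (x (n + 1)) := by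
  rw [weight, weight, Finset.prod_range_succ, mul_assoc]

theorem nullSingletonClass_measure (D : MarkovData) {ρ : ℝ} (hρ : ρ < 1)
    (htrans : ∀ n a b, D.trans n a b ≤ ρ) : NullSingletonClass D.measure := by
  have hρ0 : 0 ≤ ρ := (D.trans_nonneg 0 0 0).trans (htrans 0 0 0)
  refine ⟨fun x => ?_⟩
  have hle : ∀ n, D.measure {x} ≤ ENNReal.ofReal (D.init (x 0) * ρ ^ n) := by
    intro n
    refine (measure_mono (Set.singleton_subset_iff.2 (mem_cyl_self n x))).trans ?_
    rw [measure_cyl]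
    refine ENNReal.ofReal_le_ofReal (mul_le_mul_of_nonneg_left ?_ (D.init_nonneg _))
    calc _ ≤ ∏ i ∈ Finset.range n, ρ :=
          Finset.prod_le_prod (fun _ _ => D.trans_nonneg _ _ _) fun _ _ => htrans _ _ _
      _ = ρ ^ n := by simp
  have hlim : Filter.Tendsto (fun n => ENNReal.ofReal (D.init (x 0) * ρ ^ n)) Filter.atTop
      (nhds 0) := by
    have := (tendsto_pow_atTop_nhds_zero_of_lt_one hρ0 hρ).const_mul (D.init (x 0))
    rw [mul_zero] at this
    simpa using ENNReal.tendsto_ofReal this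
  exact le_antisymm (ge_of_tendsto' hlim hle) zero_le

/-- Each further letter costs at most a factor `δ`, so extensions by boundedly many letters keep a
fixed proportion of a cylinder. -/
theorem le_measure_cyl_add (D : MarkovData) {δ : ℝ} (hδ : 0 ≤ δ)
    (htrans : ∀ n a b, δ ≤ D.trans n a b) (n k : ℕ) (a : ℕ → Fin 2) :
    ENNReal.ofReal (δ ^ k) * D.measure (Cyl n a) ≤ D.measure (Cyl (n + k) a) := by
  rw [measure_cyl, measure_cyl, ← ENNReal.ofReal_mul (by positivity)]
  refine ENNReal.ofReal_le_ofReal ?_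
  have hw : ∀ m, 0 ≤ D.weight m a := fun m =>
    mul_nonneg (D.init_nonneg _) (Finset.prod_nonneg fun _ _ => D.trans_nonneg _ _ _)
  induction k with
  | zero => simp
  | succ k ih =>
    rw [← add_assoc, weight_succ, pow_succ]
    nlinarith [mul_le_mul ih (htrans (n + k) (a (n + k)) (a (n + k + 1))) hδ (hw _)]

end MarkovData

/-! ### Markov measures whose weights are governed by the counting cocycle -/

/-- The Markov measure `D.measure` has positive transition probabilities, bounded away from `0`
and `1`, and its Radon-Nikodym cocycle is the counting cocycle, twisted by `φ`, `r`, `s`. -/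
structure MarkovData.HasCountWeights (D : MarkovData) (φ : (ℕ → Fin 2) → PosReal)
    (r s : PosReal) : Prop where
  init_pos : ∀ a, 0 < D.init a
  exists_lower : ∃ δ : ℝ, 0 < δ ∧ δ ≤ 1 ∧ ∀ n a b, δ ≤ D.trans n a b
  exists_upper : ∃ ρ : ℝ, ρ < 1 ∧ ∀ n a b, D.trans n a b ≤ ρ
  measurable : Measurable φ
  weight_eq : ∀ n x y, (∀ i ≥ n, x i = y i) →
    D.weight n y = D.weight n x * (twistedCocycle φ r s x y).1

namespace MarkovData.HasCountWeights

variable {D : MarkovData} {φ : (ℕ → Fin 2) → PosReal} {r s : PosReal}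

theorem trans_pos (H : D.HasCountWeights φ r s) (n : ℕ) (a b : Fin 2) : 0 < D.trans n a b := by
  obtain ⟨δ, h0, -, h⟩ := H.exists_lower
  exact h0.trans_le (h n a b)

/-- By `weight_eq` the value is a ratio of weights, which depend only on the coordinates up to `n`,
although `φ` is merely Borel here. -/
theorem twistedCocycle_congr (H : D.HasCountWeights φ r s) {h : ℕ →₀ Fin 2} {n : ℕ}
    (hn : ∀ i ≥ n, h i = 0) {a x : ℕ → Fin 2} (hx : x ∈ Cyl n a) :
    twistedCocycle φ r s x (shiftBy h x) = twistedCocycle φ r s a (shiftBy h a) := by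
  have key : ∀ z : ℕ → Fin 2, ∀ i ≥ n, z i = shiftBy h z i := fun z i hi => by
    simp [shiftBy_apply, hn i hi]
  have h1 := H.weight_eq n x _ (key x)
  have h2 := H.weight_eq n a _ (key a)
  rw [D.weight_congr hx, D.weight_congr ((shiftBy_mem_cyl_iff h n a x).2 hx), h2] at h1
  exact Subtype.ext (mul_left_cancel₀ (D.weight_pos H.init_pos H.trans_pos n a).ne' h1).symm

theorem measurable_shiftBy (H : D.HasCountWeights φ r s) (h : ℕ →₀ Fin 2) :
    Measurable fun x => ENNReal.ofReal (twistedCocycle φ r s x (shiftBy h x)).1 :=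
  ((isCocycle_twistedCocycle H.measurable r s D.measure).measurable_apply
    (shiftBy h).measurable (tailRel_shiftBy h)).subtype_val.ennreal_ofReal

/-- On cylinders beyond the support of `h` the density is constant, and the identity reduces to
`weight_eq`. -/
theorem map_shiftBy_symm (H : D.HasCountWeights φ r s) (h : ℕ →₀ Fin 2) :
    D.measure.map (shiftBy h).symm = D.measure.withDensity
      fun x => ENNReal.ofReal (twistedCocycle φ r s x (shiftBy h x)).1 := by
  obtain ⟨N, hN⟩ := exists_support_bound h
  have : IsFiniteMeasure (D.measure.map (shiftBy h).symm) :=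
    Measure.isFiniteMeasure_map _ _
  refine measure_ext_of_cyl N fun n hn a => ?_
  rw [withDensity_apply _ (measurableSet_cyl n a),
    setLIntegral_congr_fun (g := fun _ => ENNReal.ofReal (twistedCocycle φ r s a (shiftBy h a)).1)
      (measurableSet_cyl n a) fun x hx => by
        simp only [H.twistedCocycle_congr (fun i hi => hN i (hn.trans hi)) hx],
    setLIntegral_const, MeasurableEquiv.map_apply]
  have hset : (shiftBy h).symm ⁻¹' Cyl n a = Cyl n (shiftBy h a) := by
    ext x
    rw [Set.mem_preimage, ← shiftBy_mem_cyl_iff h, MeasurableEquiv.apply_symm_apply]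
  rw [hset, D.measure_cyl, D.measure_cyl, mul_comm, ← ENNReal.ofReal_mul
    (D.weight_pos H.init_pos H.trans_pos n a).le]
  congr 1
  exact H.weight_eq n a _ fun i hi => by simp [shiftBy_apply, hN i (hn.trans hi)]

theorem map_shiftBy_symm_apply (H : D.HasCountWeights φ r s) {h : ℕ →₀ Fin 2} {n : ℕ}
    (hn : ∀ i ≥ n, h i = 0) {a : ℕ → Fin 2} {S : Set (ℕ → Fin 2)} (hS : MeasurableSet S)
    (hSa : S ⊆ Cyl n a) : D.measure ((shiftBy h).symm ⁻¹' S) =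
      ENNReal.ofReal (twistedCocycle φ r s a (shiftBy h a)).1 * D.measure S := by
  rw [← MeasurableEquiv.map_apply, H.map_shiftBy_symm, withDensity_apply _ hS,
    setLIntegral_congr_fun (g := fun _ => ENNReal.ofReal (twistedCocycle φ r s a (shiftBy h a)).1)
      hS fun x hx => by simp only [H.twistedCocycle_congr hn (hSa hx)],
    setLIntegral_const]

theorem measure_preimage_shiftBy (H : D.HasCountWeights φ r s) (h : ℕ →₀ Fin 2)
    {S : Set (ℕ → Fin 2)} (hS : D.measure S = 0) : D.measure (shiftBy h ⁻¹' S) = 0 := by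
  have h1 := H.map_shiftBy_symm (-h)
  have h2 : D.measure.map (shiftBy (-h)).symm S = 0 := by
    rw [h1]
    exact withDensity_absolutelyContinuous _ _ hS
  rwa [MeasurableEquiv.map_apply, shiftBy_symm, neg_neg] at h2

theorem ae_shiftBy (H : D.HasCountWeights φ r s) (h : ℕ →₀ Fin 2) {p : (ℕ → Fin 2) → Prop}
    (hp : ∀ᵐ x ∂D.measure, p x) : ∀ᵐ x ∂D.measure, p (shiftBy h x) :=
  H.measure_preimage_shiftBy h hp

/-- Cut the space into the countably many pieces on which `γ` agrees with a given translation; they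
are disjoint because translations act freely. -/
theorem map_symm_eq_withDensity (H : D.HasCountWeights φ r s) (γ : (ℕ → Fin 2) ≃ᵐ (ℕ → Fin 2))
    (hγ : ∀ x, TailRel x (γ x)) : D.measure.map γ.symm = D.measure.withDensity
      fun x => ENNReal.ofReal (twistedCocycle φ r s x (γ x)).1 := by
  ext A hA
  set B : (ℕ →₀ Fin 2) → Set (ℕ → Fin 2) := fun h => {x | x ∈ A ∧ shiftBy h x = γ x} with hB
  have hBm : ∀ h, MeasurableSet (B h) := fun h =>
    hA.inter (measurableSet_eq_fun (shiftBy h).measurable γ.measurable)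
  have hdisj : Pairwise (Function.onFun Disjoint B) := by
    intro h k hhk
    refine Set.disjoint_left.2 fun x hx hx' => hhk ?_
    have := hx.2.trans hx'.2.symm
    simp only [shiftBy_apply, add_right_inj] at this
    exact DFunLike.coe_injective this
  have hU : A = ⋃ h, B h := by
    ext x
    simp only [hB, Set.mem_iUnion, Set.mem_ofPred_eq, exists_and_left]
    exact ⟨fun hx => ⟨hx, tailRel_iff_exists_shiftBy.1 (hγ x)⟩, fun hx => hx.1⟩
  rw [hU, measure_iUnion hdisj hBm, measure_iUnion hdisj hBm]
  refine tsum_congr fun h => ?_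
  have h1 : γ.symm ⁻¹' B h = (shiftBy h).symm ⁻¹' B h := by
    rw [← MeasurableEquiv.image_eq_preimage_symm, ← MeasurableEquiv.image_eq_preimage_symm]
    exact Set.image_congr fun x hx => hx.2.symm
  rw [MeasurableEquiv.map_apply, h1, ← MeasurableEquiv.map_apply, H.map_shiftBy_symm,
    withDensity_apply _ (hBm h), withDensity_apply _ (hBm h)]
  exact setLIntegral_congr_fun (hBm h) fun x hx => by simp only [hx.2]

theorem isRadonNikodymCocycle (H : D.HasCountWeights φ r s) :
    IsRadonNikodymCocycle TailRel D.measure (twistedCocycle φ r s) where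
  isCocycle := isCocycle_twistedCocycle H.measurable r s _
  eq_rnDeriv γ hγ := by
    rw [H.map_symm_eq_withDensity γ hγ]
    exact (Measure.rnDeriv_withDensity _ ((isCocycle_twistedCocycle H.measurable r s
      D.measure).measurable_apply γ.measurable hγ).subtype_val.ennreal_ofReal).symm

end MarkovData.HasCountWeights

/-! ### Ergodicity of the counting cocycle -/

theorem countCocycle_congr {h : ℕ →₀ Fin 2} {n : ℕ} (hn : ∀ i ≥ n, h i = 0) {a x : ℕ → Fin 2}
    (hx : x ∈ Cyl n a) : countCocycle x (shiftBy h x) = countCocycle a (shiftBy h a) := by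
  have key : ∀ z : ℕ → Fin 2, ∀ i ≥ n, z i = shiftBy h z i := fun z i hi => by
    simp [shiftBy_apply, hn i hi]
  rw [countCocycle_eq (key x), countCocycle_eq (key a), pathCount_congr hx,
    pathCount_congr ((shiftBy_mem_cyl_iff h n a x).2 hx)]

/-- The sequence `a 0, …, a n, 0, c, d, 0, 0, …`. -/
def extendWord (n : ℕ) (a : ℕ → Fin 2) (c d : Fin 2) (i : ℕ) : Fin 2 :=
  if i ≤ n then a i else if i = n + 2 then c else if i = n + 3 then d else 0

theorem extendWord_mem_cyl (n : ℕ) (a : ℕ → Fin 2) (c d : Fin 2) : extendWord n a c d ∈ Cyl n a :=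
  fun i hi => by simp [extendWord, hi]

theorem pathCount_extendWord (n : ℕ) (a : ℕ → Fin 2) (c d : Fin 2) :
    pathCount (n + 3) (extendWord n a c d) =
      pathCount n a + transitionCount (a n) 0 + transitionCount 0 c + transitionCount c d := by
  have h : ∀ m, pathCount (m + 1) (extendWord n a c d) = pathCount m (extendWord n a c d) +
      transitionCount (extendWord n a c d m) (extendWord n a c d (m + 1)) := fun m =>
    Finset.sum_range_succ _ _
  rw [h, h, h, pathCount_congr (extendWord_mem_cyl n a c d)]
  simp [extendWord]

/-- The separating `0` makes the transition out of `a n` common to both words, so the change of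
count does not depend on `a`. -/
theorem countCocycle_extendWord (n : ℕ) (a : ℕ → Fin 2) (c c' d : Fin 2) :
    countCocycle (extendWord n a c d) (extendWord n a c' d) =
      transitionCount 0 c' + transitionCount c' d - (transitionCount 0 c + transitionCount c d) := by
  have : ∀ i ≥ n + 3, extendWord n a c d i = extendWord n a c' d i := fun i hi => by
    have h1 : ¬ i ≤ n := by omega
    have h2 : ¬ i = n + 2 := by omega
    simp only [extendWord, h1, h2, if_false]
  rw [countCocycle_eq this, pathCount_extendWord, pathCount_extendWord]
  abel

namespace MarkovData.HasCountWeights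

variable {D : MarkovData} {φ : (ℕ → Fin 2) → PosReal} {r s : PosReal}

/-- An extension by at most three letters occupies at least `δ ^ 3` of the cylinder, so it suffices
that `E` misses less than half that proportion. Three letters are what `extendWord` appends. -/
theorem exists_cyl_half_full (H : D.HasCountWeights φ r s) {E : Set (ℕ → Fin 2)}
    (hE : MeasurableSet E) (hμ : D.measure E ≠ 0) :
    ∃ N, ∀ n ≥ N, ∃ a, ∀ b ∈ Cyl n a, ∀ k ≤ 3,
      D.measure (Cyl (n + k) b \ E) < 2⁻¹ * D.measure (Cyl (n + k) b) := by
  obtain ⟨δ, h0, h1, hδ⟩ := H.exists_lower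
  obtain ⟨N, hN⟩ := exists_cyl_measure_diff_lt D.measure hE hμ
    (ε := 2⁻¹ * ENNReal.ofReal (δ ^ 3))
    (mul_ne_zero (by simp) (ENNReal.ofReal_pos.2 (by positivity)).ne')
    (mul_le_one' (by simp) (by simpa using pow_le_one₀ h0.le h1))
  refine ⟨N, fun n hn => ?_⟩
  obtain ⟨a, ha⟩ := hN n hn
  refine ⟨a, fun b hb k hk => ?_⟩
  rw [← cyl_congr hb] at ha
  calc D.measure (Cyl (n + k) b \ E) ≤ D.measure (Cyl n b \ E) :=
        measure_mono (Set.sdiff_subset_sdiff_left fun x hx i hi => hx i (by omega))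
    _ < 2⁻¹ * ENNReal.ofReal (δ ^ 3) * D.measure (Cyl n b) := ha
    _ ≤ 2⁻¹ * (ENNReal.ofReal (δ ^ k) * D.measure (Cyl n b)) := by
        rw [mul_assoc]
        gcongr 2⁻¹ * (ENNReal.ofReal ?_ * _)
        exact pow_le_pow_of_le_one h0.le h1 hk
    _ ≤ _ := by
        gcongr
        exact D.le_measure_cyl_add h0.le hδ n k b

/-- Translation by `h` scales the measure on the cylinder by a constant, hence preserves
proportions. Two subsets that each miss less than half must meet in positive measure. -/
theorem exists_shiftBy_mem (H : D.HasCountWeights φ r s) {h : ℕ →₀ Fin 2} {n : ℕ}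
    (hn : ∀ i ≥ n, h i = 0) {a : ℕ → Fin 2} {E F : Set (ℕ → Fin 2)} (hF : MeasurableSet F)
    (hE' : D.measure (Cyl n a \ E) < 2⁻¹ * D.measure (Cyl n a))
    (hF' : D.measure (Cyl n (shiftBy h a) \ F) < 2⁻¹ * D.measure (Cyl n (shiftBy h a)))
    {p : (ℕ → Fin 2) → Prop} (hp : ∀ᵐ x ∂D.measure, p x) :
    ∃ x ∈ Cyl n a, x ∈ E ∧ shiftBy h x ∈ F ∧ p x := by
  set T : Set (ℕ → Fin 2) := Cyl n a ∩ shiftBy h ⁻¹' Fᶜ with hT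
  set c := ENNReal.ofReal (twistedCocycle φ r s a (shiftBy h a)).1 with hc
  have hpre : (shiftBy h).symm ⁻¹' Cyl n a = Cyl n (shiftBy h a) := by
    ext x
    rw [Set.mem_preimage, ← shiftBy_mem_cyl_iff h, MeasurableEquiv.apply_symm_apply]
  have hTpre : (shiftBy h).symm ⁻¹' T = Cyl n (shiftBy h a) \ F := by
    rw [hT, Set.preimage_inter, hpre, ← Set.preimage_comp]
    simp [Set.sdiff_eq]
  have hTm : MeasurableSet T := (measurableSet_cyl n a).inter ((shiftBy h).measurable hF.compl)
  have hc0 : c ≠ 0 := (ENNReal.ofReal_pos.2 (twistedCocycle φ r s a (shiftBy h a)).2).ne'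
  rw [← hTpre, ← hpre, H.map_shiftBy_symm_apply hn hTm Set.inter_subset_left,
    H.map_shiftBy_symm_apply hn (measurableSet_cyl n a) subset_rfl, mul_left_comm,
    ENNReal.mul_lt_mul_iff_right hc0 ENNReal.ofReal_ne_top] at hF'
  by_contra! hcon
  have hsub : Cyl n a ⊆ (Cyl n a \ E) ∪ T ∪ {x | ¬ p x} := by
    intro x hx
    by_cases h1 : x ∈ E
    · by_cases h2 : shiftBy h x ∈ F
      · exact Or.inr (hcon x hx h1 h2)
      · exact Or.inl (Or.inr ⟨hx, h2⟩)
    · exact Or.inl (Or.inl ⟨hx, h1⟩)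
  have hlt : D.measure (Cyl n a) < D.measure (Cyl n a) := calc
    D.measure (Cyl n a) ≤ D.measure (Cyl n a \ E) + D.measure T + D.measure {x | ¬ p x} :=
      (measure_mono hsub).trans ((measure_union_le _ _).trans (by gcongr; exact measure_union_le _ _))
    _ = D.measure (Cyl n a \ E) + D.measure T := by rw [show D.measure {x | ¬ p x} = 0 from hp, add_zero]
    _ < 2⁻¹ * D.measure (Cyl n a) + 2⁻¹ * D.measure (Cyl n a) := ENNReal.add_lt_add hE' hF'
    _ = D.measure (Cyl n a) := by rw [← add_mul, ENNReal.inv_two_add_inv_two, one_mul]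
  exact lt_irrefl _ hlt

/-- Families of sets that are almost invariant under the skew product with the counting cocycle. -/
def IsInvariantFamily (D : MarkovData) (A : ℤ × ℤ → Set (ℕ → Fin 2)) : Prop :=
  ∀ h g, ∀ᵐ x ∂D.measure, x ∈ A g → shiftBy h x ∈ A (g + countCocycle x (shiftBy h x))

/-- Were the difference of positive measure, replacing `c` by `c'` behind a nearly filled cylinder
would carry some point of it into the same difference, while invariance puts the image in the
translated set. -/
theorem measure_diff_translate_eq_zero (H : D.HasCountWeights φ r s)
    {A : ℤ × ℤ → Set (ℕ → Fin 2)} (hA : ∀ g, MeasurableSet (A g)) (hinv : IsInvariantFamily D A)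
    (g : ℤ × ℤ) (c c' d : Fin 2) :
    D.measure (A g \ A (g + (transitionCount 0 c' + transitionCount c' d -
      (transitionCount 0 c + transitionCount c d)))) = 0 := by
  set v := transitionCount 0 c' + transitionCount c' d -
      (transitionCount 0 c + transitionCount c d) with hv
  by_contra hne
  obtain ⟨N, hN⟩ := H.exists_cyl_half_full ((hA g).diff (hA (g + v))) hne
  obtain ⟨a, ha⟩ := hN N le_rfl
  set h := diffBelow (N + 3) (extendWord N a c d) (extendWord N a c' d) with hh
  have hsh : shiftBy h (extendWord N a c d) = extendWord N a c' d := shiftBy_diffBelow fun i hi => by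
    have h1 : ¬ i ≤ N := by omega
    have h2 : ¬ i = N + 2 := by omega
    simp only [extendWord, h1, h2, if_false]
  have hn : ∀ i ≥ N + 3, h i = 0 := fun i hi => diffBelow_eq_zero hi
  obtain ⟨x, hx, hx1, hx2, hx3⟩ := H.exists_shiftBy_mem hn
    ((hA g).diff (hA (g + v))) (ha _ (extendWord_mem_cyl N a c d) 3 le_rfl)
    (by rw [hsh]; exact ha _ (extendWord_mem_cyl N a c' d) 3 le_rfl) (hinv h g)
  have := hx3 hx1.1
  rw [countCocycle_congr hn hx, hsh, countCocycle_extendWord] at this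
  exact hx2.2 this

theorem measure_diff_eq_zero (H : D.HasCountWeights φ r s)
    {A : ℤ × ℤ → Set (ℕ → Fin 2)} (hA : ∀ g, MeasurableSet (A g)) (hinv : IsInvariantFamily D A)
    (g g' : ℤ × ℤ) : D.measure (A g \ A g') = 0 := by
  have htrans : ∀ {S T U : Set (ℕ → Fin 2)}, D.measure (S \ T) = 0 → D.measure (T \ U) = 0 →
      D.measure (S \ U) = 0 := fun {S T U} h1 h2 =>
    measure_mono_null (sdiff_triangle S T U) (measure_union_null h1 h2)
  -- Asking for both signs makes the admissible translations a subgroup; the letter changes below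
  -- put `(1, 0)` and `(1, 1)` into it.
  let K : AddSubgroup (ℤ × ℤ) :=
    { carrier := {v | ∀ g, D.measure (A g \ A (g + v)) = 0 ∧ D.measure (A g \ A (g + -v)) = 0}
      zero_mem' := fun g => by simp
      add_mem' := fun {v w} hv hw g => ⟨by
          rw [← add_assoc]
          exact htrans (hv g).1 (hw _).1, by
          rw [neg_add, ← add_assoc]
          exact htrans (hv g).2 (hw _).2⟩
      neg_mem' := fun {v} hv g => ⟨(hv g).2, by simpa using (hv g).1⟩ }
  have key : ∀ c d, transitionCount 0 c + transitionCount c d -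
      (transitionCount 0 0 + transitionCount 0 d) ∈ K := fun c d g =>
    ⟨H.measure_diff_translate_eq_zero hA hinv g 0 c d, by
      rw [neg_sub]
      exact H.measure_diff_translate_eq_zero hA hinv g c 0 d⟩
  have h1 : ((1, 0) : ℤ × ℤ) ∈ K := by simpa [transitionCount] using key 1 1
  have h2 : ((1, 1) : ℤ × ℤ) ∈ K := by simpa [transitionCount] using key 1 0
  have h3 : g' - g ∈ K := by
    have : g' - g = ((g' - g).1 - (g' - g).2) • ((1, 0) : ℤ × ℤ) + (g' - g).2 • ((1, 1) : ℤ × ℤ) := by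
      ext <;> simp
    rw [this]
    exact K.add_mem (K.zsmul_mem h1 _) (K.zsmul_mem h2 _)
  simpa using (h3 g).1

/-- The skew product of the tail relation with the counting cocycle is ergodic. -/
theorem isInvariantFamily_zero_one (H : D.HasCountWeights φ r s)
    {A : ℤ × ℤ → Set (ℕ → Fin 2)} (hA : ∀ g, MeasurableSet (A g)) (hinv : IsInvariantFamily D A) :
    (∀ g, D.measure (A g) = 0) ∨ ∀ g, D.measure (A g)ᶜ = 0 := by
  by_contra! hcon
  obtain ⟨⟨g, hg⟩, g', hg'⟩ := hcon
  -- All `A k` agree up to null sets, so if `A g'` is not conull, the complement of their union has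
  -- positive measure. Some translation carries a point of `A g` into it, against invariance.
  have hU : MeasurableSet (⋃ k, A k)ᶜ := (MeasurableSet.iUnion hA).compl
  have hUne : D.measure (⋃ k, A k)ᶜ ≠ 0 := fun h0 => hg' <| by
    refine measure_mono_null (t := (⋃ k, A k)ᶜ ∪ ⋃ k, A k \ A g') (fun x hx => ?_)
      (measure_union_null h0 (measure_iUnion_null fun k => H.measure_diff_eq_zero hA hinv k g'))
    by_cases h : x ∈ ⋃ k, A k
    · obtain ⟨k, hk⟩ := Set.mem_iUnion.1 h
      exact Or.inr (Set.mem_iUnion.2 ⟨k, hk, hx⟩)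
    · exact Or.inl h
  obtain ⟨N, hN⟩ := H.exists_cyl_half_full (hA g) hg
  obtain ⟨M, hM⟩ := H.exists_cyl_half_full hU hUne
  set n := max N M
  obtain ⟨a, ha⟩ := hN n (le_max_left _ _)
  obtain ⟨b, hb⟩ := hM n (le_max_right _ _)
  have hagree : ∀ i ≥ n + 1, extendWord n a 0 0 i = extendWord n b 0 0 i := fun i hi => by
    have h1 : ¬ i ≤ n := by omega
    simp only [extendWord, h1, if_false]
  obtain ⟨x, -, hx1, hx2, hx3⟩ := H.exists_shiftBy_mem (fun i hi => diffBelow_eq_zero hi)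
    hU (ha _ (extendWord_mem_cyl n a 0 0) 1 (by norm_num))
    (by rw [shiftBy_diffBelow hagree]; exact hb _ (extendWord_mem_cyl n b 0 0) 1 (by norm_num))
    (hinv _ g)
  exact hx2 (Set.mem_iUnion.2 ⟨_, hx3 hx1⟩)

/-! ### The tail relation -/

theorem isErgodicNonsingular (H : D.HasCountWeights φ r s) :
    IsErgodicNonsingular TailRel D.measure where
  equivalence := tailRel_equivalence
  measurableSet := measurableSet_tailRel
  countable := countable_tailRel
  sigmaFinite := inferInstance
  noAtoms := by
    obtain ⟨ρ, h1, h2⟩ := H.exists_upper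
    exact D.nullSingletonClass_measure h1 h2
  nonsingular A _ hA0 := by
    refine measure_mono_null (t := ⋃ h, shiftBy h ⁻¹' A) ?_
      (measure_iUnion_null fun h => H.measure_preimage_shiftBy h hA0)
    rintro y ⟨x, hx, hxy⟩
    obtain ⟨h, rfl⟩ := tailRel_iff_exists_shiftBy.1 hxy
    exact Set.mem_iUnion.2 ⟨-h, by rwa [Set.mem_preimage, shiftBy_neg_apply_shiftBy]⟩
  ergodic A hA hinv := by
    refine (H.isInvariantFamily_zero_one (A := fun _ => A) (fun _ => hA) fun h g =>
      Filter.Eventually.of_forall fun x hx => ?_).imp (fun h => h 0) fun h => h 0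
    exact (hinv _ _ (tailRel_shiftBy h x)).1 hx

end MarkovData.HasCountWeights

/-! ### Ergodicity of dense translations -/

/-- The restriction of `η` to `B` is invariant under `S`, hence by continuity under all of `G`.
Uniqueness of Haar measure makes it a multiple of `η`, and it vanishes on `Bᶜ`. -/
theorem measure_zero_or_compl_zero_of_dense {G : Type*} [Group G] [TopologicalSpace G]
    [IsTopologicalGroup G] [LocallyCompactSpace G] [SecondCountableTopology G] [T2Space G]
    [TopologicalSpace.PseudoMetrizableSpace G]
    [MeasurableSpace G] [BorelSpace G] (η : Measure G) [η.IsHaarMeasure] {S : Set G}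
    (hS : Dense S) {B : Set G} (hB : MeasurableSet B) (hinv : ∀ g ∈ S, ∀ t, t ∈ B ↔ g * t ∈ B) :
    η B = 0 ∨ η Bᶜ = 0 := by
  set ρ := η.restrict B with hρ
  have hmap : ∀ g ∈ S, ρ.map (fun t => g * t) = ρ := by
    intro g hg
    have hpre : (fun t => g * t) ⁻¹' B = B := by
      ext t
      exact (hinv g hg t).symm
    have := (measurePreserving_mul_left η g).restrict_preimage hB
    rw [hpre] at this
    exact this.map_eq
  have hinvt : ∀ g : G, ρ.map (fun t => g * t) = ρ := by
    intro g
    have : (ρ.map fun t => g * t).Regular := Measure.Regular.map (Homeomorph.mulLeft g)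
    refine Measure.ext_of_integral_eq_on_compactlySupported fun f => ?_
    have hint : ∀ g : G, ∫ y, f y ∂(ρ.map fun t => g * t) = ∫ y, f (g * y) ∂ρ := fun g =>
      integral_map (measurable_const_mul g).aemeasurable f.continuous.aestronglyMeasurable
    rw [hint]
    have hcont : Continuous fun x : G => ∫ y, f (x * y) ∂ρ := by
      -- The integral is rewritten with inverses to match the convolution form `y⁻¹ * x`, for which
      -- continuity is known.
      have h1 : Continuous fun x : G => ∫ y, f ((y⁻¹ * x)⁻¹) ∂ρ :=
        continuous_integral_apply_inv_mul (g := fun x : G => f x⁻¹)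
          (f.continuous.comp continuous_inv)
          (f.hasCompactSupport.comp_homeomorph (Homeomorph.inv G))
      have h2 := h1.comp continuous_inv
      simpa [Function.comp_def] using h2
    have heq : (fun x : G => ∫ y, f (x * y) ∂ρ) = fun _ => ∫ y, f y ∂ρ :=
      Continuous.ext_on hS hcont continuous_const fun x hx => by
        conv_rhs => rw [← hmap x hx]
        rw [hint]
    exact congrFun heq g
  have : ρ.IsMulLeftInvariant := ⟨hinvt⟩
  have hsmul := Measure.isMulLeftInvariant_eq_smul ρ η
  by_cases hc : ρ.haarScalarFactor η = 0
  · left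
    rw [hc, zero_smul] at hsmul
    exact Measure.restrict_eq_zero.1 hsmul
  · right
    have h0 : ρ Bᶜ = 0 := by
      rw [hρ, Measure.restrict_apply hB.compl, Set.compl_inter_self, measure_empty]
    rw [hsmul, Measure.smul_apply] at h0
    simpa [hc, ENNReal.smul_def] using h0

/-! ### Ergodicity of twisted cocycles -/

namespace MarkovData.HasCountWeights

variable {D : MarkovData} {φ : (ℕ → Fin 2) → PosReal} {r s : PosReal}

/-- The map `T` untwists `ψ` and preserves the product measure. For fixed `t` the slices over the
coset of `t` form an invariant family, so each slice is null or conull, and which one occurs is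
invariant under the group generated by `u` and `v`. -/
theorem isErgodicCocycle_twistedCocycle (H : D.HasCountWeights φ r s) {G : Type*} [CommGroup G]
    [TopologicalSpace G] [MeasurableSpace G] [MeasurableMul₂ G] {ψ : (ℕ → Fin 2) → G}
    (hψ : Measurable ψ) (u v : G) (η : Measure G) [η.IsHaarMeasure] [SigmaFinite η]
    (hη : ∀ B, MeasurableSet B → (∀ g t, t ∈ B ↔ pairPow u v g * t ∈ B) → η B = 0 ∨ η Bᶜ = 0) :
    IsErgodicCocycle TailRel D.measure (twistedCocycle ψ u v) := by
  refine ⟨η, inferInstance, inferInstance, fun A hA hinv => ?_⟩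
  set T : (ℕ → Fin 2) × G → (ℕ → Fin 2) × G := fun p => (p.1, ψ p.1 * p.2) with hT
  have hTm : Measurable T := measurable_fst.prodMk ((hψ.comp measurable_fst).mul measurable_snd)
  have hTη : ∀ E, MeasurableSet E → D.measure.prod η (T ⁻¹' E) = D.measure.prod η E := by
    intro E hE
    rw [Measure.prod_apply (hTm hE), Measure.prod_apply hE]
    exact lintegral_congr fun x => measure_preimage_mul η (ψ x) (Prod.mk x ⁻¹' E)
  have hdich : ∀ t, (∀ g, D.measure {x | T (x, pairPow u v g * t) ∈ A} = 0) ∨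
      ∀ g, D.measure {x | T (x, pairPow u v g * t) ∈ A}ᶜ = 0 := by
    intro t
    refine H.isInvariantFamily_zero_one
      (A := fun g => {x | T (x, pairPow u v g * t) ∈ A})
      (fun g => (hTm.comp (measurable_id.prodMk measurable_const)) hA)
      fun h g => Filter.Eventually.of_forall fun x hx => ?_
    refine (hinv _ _ ⟨tailRel_shiftBy h x, ?_⟩).1 hx
    simp only [hT, twistedCocycle, pairPow_add]
    rw [show (ψ x)⁻¹ * pairPow u v (countCocycle x (shiftBy h x)) * ψ (shiftBy h x) *
      (ψ x * (pairPow u v g * t)) = (ψ x)⁻¹ * ψ x * (ψ (shiftBy h x) *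
      (pairPow u v g * pairPow u v (countCocycle x (shiftBy h x)) * t)) by
        simp only [mul_comm, mul_left_comm, mul_assoc]]
    rw [inv_mul_cancel, one_mul]
  have h1 : ∀ t, pairPow u v 0 * t = t := fun t => by rw [pairPow_zero, one_mul]
  set B : Set G := {t | D.measure ((fun x => (x, t)) ⁻¹' (T ⁻¹' A)) = 0} with hB
  have hBm : MeasurableSet B :=
    measurable_measure_prodMk_right (hTm hA) (measurableSet_singleton 0)
  have hne : ∀ E : Set (ℕ → Fin 2), D.measure E = 0 → D.measure Eᶜ ≠ 0 := fun E h1 h2 => by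
    have := measure_union_null h1 h2
    simp at this
  have hBinv : ∀ g t, t ∈ B ↔ pairPow u v g * t ∈ B := by
    intro g t
    rcases hdich t with h | h
    · refine iff_of_true ?_ (h g)
      have := h 0
      rwa [h1] at this
    · refine iff_of_false (fun h' => hne _ h' ?_) fun h' => hne _ h' (h g)
      have := h 0
      rwa [h1] at this
  rcases hη B hBm hBinv with h0 | h0
  · right
    rw [← hTη _ hA.compl, Measure.prod_apply_symm (hTm hA.compl), lintegral_eq_zero_iff
      (measurable_measure_prodMk_right (hTm hA.compl))]
    filter_upwards [measure_eq_zero_iff_ae_notMem.1 h0] with t ht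
    rcases hdich t with h | h
    · refine absurd ?_ ht
      have := h 0
      rwa [h1] at this
    · have := h 0
      rwa [h1] at this
  · left
    rw [← hTη _ hA, Measure.prod_apply_symm (hTm hA), lintegral_eq_zero_iff
      (measurable_measure_prodMk_right (hTm hA))]
    filter_upwards [measure_eq_zero_iff_ae_notMem.1 h0] with t ht
    simpa [hB] using ht

theorem isErgodicCocycle_of_dense (H : D.HasCountWeights φ r s)
    (hd : Dense (Set.range (pairPow r s))) :
    IsErgodicCocycle TailRel D.measure (twistedCocycle φ r s) := by
  refine H.isErgodicCocycle_twistedCocycle H.measurable r s Measure.haar fun B hB hinv => ?_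
  refine measure_zero_or_compl_zero_of_dense _ hd hB ?_
  rintro _ ⟨g, rfl⟩ t
  exact hinv g t

end MarkovData.HasCountWeights

namespace MarkovData.HasCountWeights

variable {D : MarkovData} {φ : (ℕ → Fin 2) → PosReal} {r s : PosReal}

/-! ### Rigidity of cohomologous cocycles -/

/-- `F` separates the cosets of `Λ` by real numbers. The coset of `(χ φ⁻¹)⁻¹ r^m s^n` is an
invariant function on the skew product with the counting cocycle, so it is constant in `x` and in
`(m, n)`. -/
theorem exists_const_of_mem_subgroup (H : D.HasCountWeights φ r s) {Λ : Subgroup PosReal}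
    {F : PosReal → ℝ} (hFm : Measurable F) (hF : ∀ t t', F t = F t' ↔ t * t'⁻¹ ∈ Λ)
    {χ : (ℕ → Fin 2) → PosReal} (hχ : Measurable χ)
    (hmem : ∀ h, ∀ᵐ x ∂D.measure,
      χ x * twistedCocycle φ r s x (shiftBy h x) * (χ (shiftBy h x))⁻¹ ∈ Λ) :
    (∀ g, pairPow r s g ∈ Λ) ∧ ∃ c, ∀ᵐ x ∂D.measure, χ x * (φ x)⁻¹ * c ∈ Λ := by
  set f : ℤ × ℤ → (ℕ → Fin 2) → ℝ := fun g x => F ((χ x * (φ x)⁻¹)⁻¹ * pairPow r s g) with hf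
  have hfm : ∀ g, Measurable (f g) := fun g =>
    hFm.comp ((hχ.mul H.measurable.inv).inv.mul_const _)
  have hdich : ∀ J : Set ℝ, MeasurableSet J →
      (∀ g, D.measure (f g ⁻¹' J) = 0) ∨ ∀ g, D.measure (f g ⁻¹' J)ᶜ = 0 := by
    intro J hJ
    refine H.isInvariantFamily_zero_one (fun g => hfm g hJ) fun h g => ?_
    filter_upwards [hmem h] with x hx hxJ
    have : f (g + countCocycle x (shiftBy h x)) (shiftBy h x) = f g x := by
      refine (hF _ _).2 ?_
      convert hx using 1
      simp only [twistedCocycle, pairPow_add, mul_inv_rev, inv_inv]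
      calc _ = (pairPow r s g * (pairPow r s g)⁻¹) * (χ x * ((φ x)⁻¹ *
            pairPow r s (countCocycle x (shiftBy h x)) * φ (shiftBy h x)) *
            (χ (shiftBy h x))⁻¹) := by simp only [mul_comm, mul_left_comm, mul_assoc]
        _ = _ := by rw [mul_inv_cancel, one_mul]
    rwa [Set.mem_preimage, this]
  obtain ⟨c, hc⟩ := Filter.exists_eventuallyEq_const_of_forall_separating (l := ae D.measure)
    (f := f 0) MeasurableSet fun J hJ => by
      rcases hdich J hJ with h | h
      · exact Or.inr (measure_eq_zero_iff_ae_notMem.1 (h 0))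
      · exact Or.inl (h 0)
  have hall : ∀ g, ∀ᵐ x ∂D.measure, f g x = c := by
    rcases hdich {c} (measurableSet_singleton c) with h | h
    · have h1 : ∀ᵐ x ∂D.measure, False := by
        filter_upwards [hc, measure_eq_zero_iff_ae_notMem.1 (h 0)] with x h1 h2 using h2 h1
      exact h1.exists.elim fun _ h => h.elim
    · exact h
  have hone : pairPow r s 0 = 1 := pairPow_zero r s
  refine ⟨fun g => ?_, ?_⟩
  · obtain ⟨x, h1, h2⟩ := ((hall g).and (hall 0)).exists
    have := (hF _ _).1 (h1.trans h2.symm)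
    rw [hone, mul_one] at this
    convert this using 1
    rw [mul_inv_cancel_comm]
  · obtain ⟨x₀, h₀⟩ := (hall 0).exists
    refine ⟨(χ x₀ * (φ x₀)⁻¹)⁻¹, ?_⟩
    filter_upwards [hall 0] with x hx
    have := (hF _ _).1 (h₀.trans hx.symm)
    rw [hone, mul_one, mul_one, inv_inv, mul_comm] at this
    exact this

/-! ### Invariant measures -/

theorem map_symm_withDensity (H : D.HasCountWeights φ r s) (γ : (ℕ → Fin 2) ≃ᵐ (ℕ → Fin 2))
    (hγ : ∀ x, TailRel x (γ x)) {f : (ℕ → Fin 2) → ℝ≥0∞} (hf : Measurable f) :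
    (D.measure.withDensity f).map γ.symm = D.measure.withDensity
      fun x => ENNReal.ofReal (twistedCocycle φ r s x (γ x)).1 * f (γ x) := by
  have hΔ : Measurable fun x => ENNReal.ofReal (twistedCocycle φ r s x (γ x)).1 :=
    ((isCocycle_twistedCocycle H.measurable r s
      D.measure).measurable_apply γ.measurable hγ).subtype_val.ennreal_ofReal
  ext A hA
  have h1 : ∫⁻ x in A, f (γ x) ∂(D.measure.map γ.symm) = ∫⁻ x in γ.symm ⁻¹' A, f x ∂D.measure := by
    rw [setLIntegral_map (f := fun x => f (γ x)) hA (hf.comp γ.measurable) γ.symm.measurable]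
    simp
  rw [MeasurableEquiv.map_apply, withDensity_apply _ (γ.symm.measurable hA), ← h1,
    H.map_symm_eq_withDensity γ hγ, withDensity_apply _ hA,
    setLIntegral_withDensity_eq_setLIntegral_mul (g := fun x => f (γ x)) _ hΔ
      (hf.comp γ.measurable) hA]
  rfl

/-- The density of an invariant measure makes the Radon-Nikodym cocycle a coboundary; rigidity
applies with `Λ` trivial. -/
theorem eq_one_of_isTypeII (H : D.HasCountWeights φ r s) (h : IsTypeII TailRel D.measure) :
    r = 1 ∧ s = 1 := by
  obtain ⟨-, ν, hν, hνμ, hμν, hinv⟩ := h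
  set f := ν.rnDeriv D.measure with hf
  have hfm : Measurable f := Measure.measurable_rnDeriv _ _
  have hfν : D.measure.withDensity f = ν := Measure.withDensity_rnDeriv_eq _ _ hνμ
  have hpos : ∀ᵐ x ∂D.measure, 0 < f x := hμν (Measure.rnDeriv_pos hνμ)
  have hfin : ∀ᵐ x ∂D.measure, f x < ∞ := Measure.rnDeriv_lt_top _ _
  set χ : (ℕ → Fin 2) → PosReal := fun x =>
    if h : 0 < (f x).toReal then ⟨(f x).toReal, h⟩ else 1 with hχ
  have hχm : Measurable χ := by
    have hval : Measurable fun x => (χ x).1 := by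
      have : (fun x => (χ x).1) = fun x => if 0 < (f x).toReal then (f x).toReal else 1 := by
        funext x
        simp only [hχ]
        split_ifs <;> rfl
      rw [this]
      exact Measurable.ite (measurableSet_lt measurable_const hfm.ennreal_toReal)
        hfm.ennreal_toReal measurable_const
    exact hval.subtype_mk
  have hχf : ∀ᵐ x ∂D.measure, f x = ENNReal.ofReal (χ x).1 := by
    filter_upwards [hpos, hfin] with x h1 h2
    have h3 := ENNReal.toReal_pos h1.ne' h2.ne
    simp only [hχ, h3, dif_pos]
    rw [ENNReal.ofReal_toReal h2.ne]
  have hmem : ∀ h, ∀ᵐ x ∂D.measure,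
      (χ x)⁻¹ * twistedCocycle φ r s x (shiftBy h x) * ((χ (shiftBy h x))⁻¹)⁻¹ ∈
        (⊥ : Subgroup PosReal) := by
    intro h
    have h1 := H.map_symm_withDensity (shiftBy h) (tailRel_shiftBy h) hfm
    rw [hfν, shiftBy_symm, hinv _ (tailRel_shiftBy (-h)), ← hfν] at h1
    replace h1 := (withDensity_eq_iff_of_sigmaFinite hfm.aemeasurable
      ((H.measurable_shiftBy h).mul (hfm.comp (shiftBy h).measurable)).aemeasurable).1 h1
    filter_upwards [h1, hχf, H.ae_shiftBy h hχf] with x h1 h2 h3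
    rw [h2, Pi.mul_apply, Function.comp_apply, h3, ← ENNReal.ofReal_mul (twistedCocycle φ r s x (shiftBy h x)).2.le,
      ENNReal.ofReal_eq_ofReal_iff (χ x).2.le (mul_pos (twistedCocycle φ r s x (shiftBy h x)).2
        (χ (shiftBy h x)).2).le] at h1
    have h4 : χ x = twistedCocycle φ r s x (shiftBy h x) * χ (shiftBy h x) := Subtype.ext h1
    rw [Subgroup.mem_bot, inv_inv, mul_assoc, ← h4, inv_mul_cancel]
  obtain ⟨h1, -⟩ := H.exists_const_of_mem_subgroup (Λ := ⊥) (F := Subtype.val)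
    measurable_subtype_coe (fun t t' => by
      rw [Subgroup.mem_bot, mul_inv_eq_one, Subtype.ext_iff]) hχm.inv hmem
  exact ⟨by simpa [pairPow] using h1 (1, 0), by simpa [pairPow] using h1 (0, 1)⟩

/-- For `r = s = 1` the cocycle is the coboundary of `φ`, so the density `φ⁻¹` gives an invariant
measure, finite by the bound `C`. -/
theorem isTypeIIOne (H : D.HasCountWeights φ r s) (hr : r = 1) (hs : s = 1) {C : ℝ}
    (hC : ∀ x, ((φ x)⁻¹).1 ≤ C) : IsTypeIIOne TailRel D.measure := by
  have hfm : Measurable fun x => ENNReal.ofReal ((φ x)⁻¹).1 :=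
    H.measurable.inv.subtype_val.ennreal_ofReal
  refine ⟨H.isErgodicNonsingular, D.measure.withDensity fun x => ENNReal.ofReal ((φ x)⁻¹).1,
    ?_, withDensity_absolutelyContinuous _ _, withDensity_absolutelyContinuous' hfm.aemeasurable
      (Filter.Eventually.of_forall fun x => (ENNReal.ofReal_pos.2 ((φ x)⁻¹).2).ne'), ?_⟩
  · refine isFiniteMeasure_withDensity (ne_top_of_le_ne_top (ENNReal.ofReal_ne_top (r := C)) ?_)
    calc _ ≤ ∫⁻ _, ENNReal.ofReal C ∂D.measure :=
          lintegral_mono fun x => ENNReal.ofReal_le_ofReal (hC x)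
      _ = _ := by simp
  · intro γ hγ
    have hγ' : ∀ x, TailRel x (γ.symm x) := fun x =>
      tailRel_equivalence.symm (by simpa using hγ (γ.symm x))
    have h1 := H.map_symm_withDensity γ.symm hγ' hfm
    rw [MeasurableEquiv.symm_symm] at h1
    rw [h1]
    congr 1
    funext x
    rw [← ENNReal.ofReal_mul (twistedCocycle φ r s x (γ.symm x)).2.le]
    congr 1
    have : twistedCocycle φ r s x (γ.symm x) * (φ (γ.symm x))⁻¹ = (φ x)⁻¹ := by
      simp [twistedCocycle, hr, hs, pairPow]
    exact congrArg Subtype.val this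

theorem isTypeIIOne_iff (H : D.HasCountWeights φ r s) {C : ℝ} (hC : ∀ x, ((φ x)⁻¹).1 ≤ C) :
    IsTypeIIOne TailRel D.measure ↔ r = 1 ∧ s = 1 := by
  refine ⟨fun ⟨h, ν, hν, h1⟩ => H.eq_one_of_isTypeII ⟨h, ν, inferInstance, h1⟩,
    fun h => H.isTypeIIOne h.1 h.2 hC⟩

end MarkovData.HasCountWeights

/-! ### Discrete subgroups of the positive reals -/

/-- Supplies a real Borel invariant of the cosets of the powers of `l`, as rigidity requires. -/
theorem mem_zpowers_iff_fract {l : PosReal} (hl : l.1 < 1) (t t' : PosReal) :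
    Int.fract (Real.log t / Real.log l) = Int.fract (Real.log t' / Real.log l) ↔
      t * t'⁻¹ ∈ Subgroup.zpowers l := by
  have hlog : Real.log l ≠ 0 := (Real.log_neg l.2 hl).ne
  rw [Int.fract_eq_fract, Subgroup.mem_zpowers_iff]
  refine exists_congr fun z => ?_
  rw [← sub_div, div_eq_iff hlog, ← Real.log_zpow, ← Real.log_div t.2.ne' t'.2.ne',
    Subtype.ext_iff]
  rw [Real.log_injOn_pos.eq_iff (Set.mem_Ioi.2 (div_pos t.2 t'.2))
    (Set.mem_Ioi.2 (zpow_pos l.2 z))]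
  exact eq_comm

theorem PosReal.zpow_injective {l : PosReal} (hl : l.1 < 1) :
    Function.Injective fun n : ℤ => l ^ n := fun _ _ h =>
  zpow_right_injective₀ l.2 hl.ne (Subtype.ext_iff.1 h)

theorem discreteTopology_zpowers {l : PosReal} (hl : l.1 < 1) :
    DiscreteTopology (Subgroup.zpowers l) := by
  refine discreteTopology_of_isOpen_singleton_one ?_
  have hopen : IsOpen {t : Subgroup.zpowers l | l.1 < t.1.1 ∧ t.1.1 < (l.1)⁻¹} :=
    have hc : Continuous fun t : Subgroup.zpowers l => t.1.1 :=
      continuous_subtype_val.comp continuous_subtype_val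
    (isOpen_lt continuous_const hc).inter (isOpen_lt hc continuous_const)
  convert hopen using 1
  ext ⟨t, n, rfl⟩
  simp only [Set.mem_singleton_iff, Set.mem_ofPred_eq]
  constructor
  · intro h
    have h2 : l ^ n = 1 := congrArg Subtype.val h
    simp only [h2]
    exact ⟨hl, (one_lt_inv₀ l.2).2 hl⟩
  · rintro ⟨h1, h2⟩
    have h3 : l.1 ^ (1 : ℤ) < l.1 ^ n := by simpa using h1
    have h4 : l.1 ^ n < l.1 ^ (-1 : ℤ) := by simpa using h2
    rw [zpow_lt_zpow_iff_right_of_lt_one₀ l.2 hl] at h3 h4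
    obtain rfl : n = 0 := by omega
    exact Subtype.ext (zpow_zero l)

/-! ### Type III and the subgroup generated by `r` and `s` -/

namespace MarkovData.HasCountWeights

variable {D : MarkovData} {φ : (ℕ → Fin 2) → PosReal} {r s : PosReal}

/-- Remove all translates of a Borel null set containing the exceptions; there are countably many,
each null by nonsingularity. -/
theorem exists_saturated (H : D.HasCountWeights φ r s) {p : (ℕ → Fin 2) → Prop}
    (hp : ∀ᵐ x ∂D.measure, p x) : ∃ B : Set (ℕ → Fin 2), MeasurableSet B ∧
      (∀ᵐ x ∂D.measure, x ∈ B) ∧ (∀ x ∈ B, p x) ∧ ∀ x y, TailRel x y → (x ∈ B ↔ y ∈ B) := by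
  obtain ⟨N, hpN, hNm, hN0⟩ := exists_measurable_superset_of_null hp
  have hsat : ∀ x y, TailRel x y → x ∈ ⋂ h, shiftBy h ⁻¹' Nᶜ → y ∈ ⋂ h, shiftBy h ⁻¹' Nᶜ := by
    intro x y hxy hx
    refine Set.mem_iInter.2 fun h => ?_
    obtain ⟨k, hk⟩ := tailRel_iff_exists_shiftBy.1
      (tailRel_equivalence.trans hxy (tailRel_shiftBy h y))
    have := Set.mem_iInter.1 hx k
    rwa [Set.mem_preimage, hk] at this
  refine ⟨⋂ h, shiftBy h ⁻¹' Nᶜ, MeasurableSet.iInter fun h =>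
    (shiftBy h).measurable hNm.compl, ?_, fun x hx => ?_,
    fun x y hxy => ⟨hsat x y hxy, hsat y x (tailRel_equivalence.symm hxy)⟩⟩
  · simp only [Set.mem_iInter]
    exact ae_all_iff.2 fun h => H.ae_shiftBy h (p := fun x => x ∉ N) (measure_eq_zero_iff_ae_notMem.1 hN0)
  · by_contra hpx
    have := Set.mem_iInter.1 hx 0
    simp only [Set.mem_preimage, shiftBy_apply, Finsupp.coe_zero, add_zero] at this
    exact this (hpN hpx)

/-- Rigidity puts `r` and `s` into the powers of `l`. Were the subgroup they generate smaller, its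
cosets would give a nontrivial invariant set `E` for the skew product with `b`. -/
theorem zpowers_eq_of_isTypeIIILambda (H : D.HasCountWeights φ r s) {l : PosReal}
    (h : IsTypeIIILambda TailRel D.measure l) :
    (∀ g, pairPow r s g ∈ Subgroup.zpowers l) ∧ ∃ g, pairPow r s g = l := by
  obtain ⟨-, hl, Δ, hΔ, b, -, ⟨χ, hχ, A, hA, hcoh⟩, η, hη, hση, herg⟩ := h
  have := discreteTopology_zpowers hl
  have hb : ∀ h, ∀ᵐ x ∂D.measure, χ x * twistedCocycle φ r s x (shiftBy h x) *
      (χ (shiftBy h x))⁻¹ = b x (shiftBy h x) := by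
    intro h
    have hA' : ∀ᵐ x ∂D.measure, x ∈ A := hA
    filter_upwards [hA', H.ae_shiftBy h hA', hΔ.eq_rnDeriv _ (tailRel_shiftBy h),
      H.isRadonNikodymCocycle.eq_rnDeriv _ (tailRel_shiftBy h)] with x h1 h2 h3 h4
    have h5 := h4.trans h3.symm
    rw [ENNReal.ofReal_eq_ofReal_iff (twistedCocycle φ r s x (shiftBy h x)).2.le
      (Δ x (shiftBy h x)).2.le] at h5
    rw [Subtype.ext h5, hcoh x h1 _ h2 (tailRel_shiftBy h x)]
    group
  obtain ⟨hmem, c, hc⟩ := H.exists_const_of_mem_subgroup (Λ := Subgroup.zpowers l)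
    (F := fun t => Int.fract (Real.log t / Real.log l))
    (measurable_fract.comp ((Real.measurable_log.comp measurable_subtype_coe).div_const _))
    (mem_zpowers_iff_fract hl) hχ fun h => (hb h).mono fun x hx => hx ▸ (b x _).2
  refine ⟨hmem, ?_⟩
  obtain ⟨B, hBm, hBae, hBp, hBsat⟩ := H.exists_saturated ((ae_all_iff.2 hb).and hc)
  set E : Set ((ℕ → Fin 2) × Subgroup.zpowers l) :=
    {p | p.1 ∈ B ∧ χ p.1 * (φ p.1)⁻¹ * c * p.2 ∈ Set.range (pairPow r s)} with hE
  have hEm : MeasurableSet E := by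
    refine (measurable_fst hBm).inter (Measurable.comp (g := fun p : (ℕ → Fin 2) ×
      Subgroup.zpowers l => χ p.1 * (φ p.1)⁻¹ * c * p.2) ?_ measurable_id
        (Set.countable_range _).measurableSet)
    exact ((((hχ.mul H.measurable.inv).mul_const c).comp measurable_fst).mul
      (measurable_subtype_coe.comp measurable_snd))
  have hEinv : ∀ p q, SkewProduct TailRel b p q → (p ∈ E ↔ q ∈ E) := by
    rintro ⟨x, t⟩ ⟨y, u⟩ ⟨hxy, hu⟩
    simp only at hxy hu
    refine and_congr_right_iff.2 ?_ |>.trans (and_congr_left_iff.2 fun _ => hBsat x y hxy)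
    intro hx
    obtain ⟨h, rfl⟩ := tailRel_iff_exists_shiftBy.1 hxy
    have h1 := (hBp x hx).1 h
    set y := shiftBy h x
    have h3 : χ y * (φ y)⁻¹ * c * u = χ x * (φ x)⁻¹ * c * t * pairPow r s (countCocycle x y) := by
      rw [hu, Subgroup.coe_mul, ← h1, twistedCocycle, mul_coboundary_cancel]
    rw [h3]
    constructor
    · rintro ⟨g, hg⟩
      exact ⟨g + countCocycle x y, by rw [pairPow_add, hg]⟩
    · rintro ⟨g, hg⟩
      refine ⟨g + -countCocycle x y, ?_⟩
      rw [pairPow_add, hg, mul_assoc, ← pairPow_add, add_neg_cancel, pairPow_zero, mul_one]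
  rcases herg E hEm hEinv with h0 | h0
  · rw [Measure.measure_prod_null hEm] at h0
    obtain ⟨x, h1, h2⟩ := (h0.and hBae).exists
    have hx := (hBp x h2).2
    have hopen : IsOpen (Prod.mk x ⁻¹' E) := isOpen_discrete _
    -- The fibre contains the inverse of the coset representative, and points of a discrete group
    -- have positive Haar measure.
    refine absurd h1 (hopen.measure_pos η ⟨⟨_, hx⟩⁻¹, h2, 0, ?_⟩).ne'
    rw [pairPow_zero]
    exact (mul_inv_cancel _).symm
  · rw [Measure.measure_prod_null hEm.compl] at h0
    obtain ⟨x, h1, h2⟩ := (h0.and hBae).exists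
    have hopen : IsOpen (Prod.mk x ⁻¹' Eᶜ) := isOpen_discrete _
    -- A conull fibre in a discrete group is everything; comparing `t = 1` with `t = l` shows that
    -- `l` is generated by `r` and `s`.
    have hall : ∀ t, (x, t) ∈ E := by
      intro t
      by_contra ht
      exact (hopen.measure_pos η ⟨t, ht⟩).ne' h1
    obtain ⟨-, g, hg⟩ := hall 1
    obtain ⟨-, g', hg'⟩ := hall ⟨l, Subgroup.mem_zpowers l⟩
    simp only [Subgroup.coe_one, mul_one] at hg
    refine ⟨g' + -g, mul_left_cancel (a := pairPow r s g) ?_⟩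
    rw [← pairPow_add, add_neg_cancel_comm_assoc, hg', hg]

theorem isTypeIII (H : D.HasCountWeights φ r s) (h : ¬ (r = 1 ∧ s = 1)) :
    IsTypeIII TailRel D.measure :=
  ⟨H.isErgodicNonsingular, fun h2 => h (H.eq_one_of_isTypeII h2)⟩

theorem isTypeIIILambda (H : D.HasCountWeights φ r s) {l : PosReal} (hl : l.1 < 1)
    (hmem : ∀ g, pairPow r s g ∈ Subgroup.zpowers l) (hgen : ∃ g, pairPow r s g = l) :
    IsTypeIIILambda TailRel D.measure l := by
  have := discreteTopology_zpowers hl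
  obtain ⟨g₀, hg₀⟩ := hgen
  let u : Subgroup.zpowers l := ⟨r, by simpa [pairPow] using hmem (1, 0)⟩
  let v : Subgroup.zpowers l := ⟨s, by simpa [pairPow] using hmem (0, 1)⟩
  have hcoe : ∀ g, (pairPow u v g).1 = pairPow r s g := fun g => rfl
  have hone : Measurable fun _ : ℕ → Fin 2 => (1 : Subgroup.zpowers l) := measurable_const
  refine ⟨H.isTypeIII ?_, hl, twistedCocycle φ r s, H.isRadonNikodymCocycle,
    twistedCocycle (fun _ => 1) u v, isCocycle_twistedCocycle hone u v _,
    ⟨φ, H.measurable, Set.univ, by simp, fun x _ y _ _ => ?_⟩,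
    H.isErgodicCocycle_twistedCocycle hone u v Measure.haar fun B _ hinv => ?_⟩
  · rintro ⟨rfl, rfl⟩
    refine hl.ne ?_
    rw [← hg₀]
    simp [pairPow]
  · simp only [twistedCocycle, inv_one, one_mul, mul_one]
    rfl
  · have hsurj : ∀ t : Subgroup.zpowers l, ∃ g, pairPow u v g = t := by
      intro t
      obtain ⟨n, hn⟩ := Subgroup.mem_zpowers_iff.1 t.2
      exact ⟨n • g₀, Subtype.ext ((hcoe _).trans (by rw [pairPow_zsmul, hg₀, hn]))⟩
    rcases B.eq_empty_or_nonempty with rfl | ⟨t, ht⟩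
    · exact Or.inl measure_empty
    · refine Or.inr ?_
      have : B = Set.univ := by
        refine Set.eq_univ_of_forall fun t' => ?_
        obtain ⟨g, hg⟩ := hsurj (t' * t⁻¹)
        have := (hinv g t).1 ht
        rwa [hg, inv_mul_cancel_right] at this
      rw [this, Set.compl_univ, measure_empty]

theorem isTypeIIILambda_iff (H : D.HasCountWeights φ r s) {l : PosReal} (hl : l.1 < 1) :
    IsTypeIIILambda TailRel D.measure l ↔
      (∀ g, pairPow r s g ∈ Subgroup.zpowers l) ∧ ∃ g, pairPow r s g = l :=
  ⟨H.zpowers_eq_of_isTypeIIILambda, fun h => H.isTypeIIILambda hl h.1 h.2⟩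

end MarkovData.HasCountWeights

/-! ### Subgroups with two generators -/

/-- Take logarithms: an additive subgroup of the reals is dense or cyclic. A generator `a ≤ 0` gives
`l = exp a < 1` unless `a = 0`. -/
theorem denseRange_pairPow_or_exists (r s : PosReal) :
    Dense (Set.range (pairPow r s)) ∨ (r = 1 ∧ s = 1) ∨ ∃ l : PosReal, l.1 < 1 ∧
      (∀ g, pairPow r s g ∈ Subgroup.zpowers l) ∧ ∃ g, pairPow r s g = l := by
  let L : ℤ × ℤ →+ ℝ :=
    { toFun := fun g => g.1 * Real.log r + g.2 * Real.log s
      map_zero' := by simp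
      map_add' := fun g h => by
        push_cast [Prod.fst_add, Prod.snd_add]
        ring }
  let e : ℝ → PosReal := fun z => ⟨Real.exp z, Real.exp_pos z⟩
  have he : ∀ g, e (L g) = pairPow r s g := fun g => by
    refine Subtype.ext ?_
    change Real.exp (g.1 * Real.log r + g.2 * Real.log s) = (r : ℝ) ^ g.1 * (s : ℝ) ^ g.2
    rw [Real.exp_add, ← Real.log_zpow, ← Real.log_zpow, Real.exp_log (zpow_pos r.2 _),
      Real.exp_log (zpow_pos s.2 _)]
  have hez : ∀ (n : ℤ) z, e (n • z) = e z ^ n := fun n z => Subtype.ext <| by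
    change Real.exp (n • z) = Real.exp z ^ n
    rw [zsmul_eq_mul, mul_comm, Real.exp_mul, Real.rpow_intCast]
  rcases AddSubgroup.dense_or_cyclic L.range with h | ⟨a, ha⟩
  · left
    have hs : Function.Surjective e := fun t =>
      ⟨Real.log t, Subtype.ext (Real.exp_log t.2)⟩
    have hd : DenseRange L := by
      rw [DenseRange, ← AddMonoidHom.coe_range]
      exact h
    have := hs.denseRange.comp hd (by fun_prop)
    rwa [show e ∘ L = pairPow r s from funext he] at this
  · right
    rw [← AddSubgroup.zmultiples_eq_closure] at ha
    wlog hneg : a ≤ 0 generalizing a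
    · exact this (-a) (by rw [ha, AddSubgroup.zmultiples_neg]) (by linarith)
    have hmem : ∀ g, ∃ n : ℤ, n • a = L g := fun g =>
      AddSubgroup.mem_zmultiples_iff.1 (ha ▸ AddMonoidHom.mem_range.2 ⟨g, rfl⟩)
    rcases hneg.eq_or_lt with rfl | hneg
    · left
      have h0 : ∀ g, pairPow r s g = 1 := fun g => by
        obtain ⟨n, hn⟩ := hmem g
        rw [← he, ← hn, smul_zero]
        exact Subtype.ext Real.exp_zero
      exact ⟨by simpa [pairPow] using h0 (1, 0), by simpa [pairPow] using h0 (0, 1)⟩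
    · right
      refine ⟨e a, Real.exp_lt_one_iff.2 hneg, fun g => ?_, ?_⟩
      · obtain ⟨n, hn⟩ := hmem g
        exact Subgroup.mem_zpowers_iff.2 ⟨n, by rw [← he, ← hn, hez]⟩
      · obtain ⟨g, hg⟩ := AddMonoidHom.mem_range.1
          (show a ∈ L.range from ha ▸ AddSubgroup.mem_zmultiples a)
        exact ⟨g, by rw [← he, hg]⟩

theorem zpowers_eq_iff {l : PosReal} (hl : l.1 < 1) (r s : PosReal) :
    ((∀ g, pairPow r s g ∈ Subgroup.zpowers l) ∧ ∃ g, pairPow r s g = l) ↔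
      ∃ p q : ℤ, IsCoprime p q ∧ r = l ^ p ∧ s = l ^ (q - p) := by
  constructor
  · rintro ⟨hmem, g, hg⟩
    obtain ⟨p, hp⟩ := Subgroup.mem_zpowers_iff.1 (hmem (1, 0))
    obtain ⟨m, hm⟩ := Subgroup.mem_zpowers_iff.1 (hmem (0, 1))
    have hp' : r = l ^ p := by simpa [pairPow] using hp.symm
    have hm' : s = l ^ m := by simpa [pairPow] using hm.symm
    refine ⟨p, m + p, ⟨g.1 - g.2, g.2, ?_⟩, hp', by rw [add_sub_cancel_right, hm']⟩
    rw [pairPow, hp', hm', ← zpow_mul, ← zpow_mul, ← zpow_add] at hg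
    have := PosReal.zpow_injective hl (hg.trans (zpow_one l).symm)
    linarith
  · rintro ⟨p, q, ⟨u, v, huv⟩, rfl, rfl⟩
    -- From `u * p + v * q = 1` follows `(u + v) * p + v * (q - p) = 1`.
    refine ⟨fun g => Subgroup.mem_zpowers_iff.2 ⟨p * g.1 + (q - p) * g.2, ?_⟩, (u + v, v), ?_⟩
    · rw [pairPow, ← zpow_mul, ← zpow_mul, ← zpow_add]
    · rw [pairPow, ← zpow_mul, ← zpow_mul, ← zpow_add,
        show p * (u + v) + (q - p) * v = 1 by linarith, zpow_one]

/-! ### The homogeneous two-state chain -/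

section TwoState

variable {α β : ℝ}

/-- The coboundary part of the Radon-Nikodym cocycle. -/
noncomputable def initFactor (D : MarkovData) (hinit : ∀ a, 0 < D.init a) (hα : 0 < α)
    (x : ℕ → Fin 2) : PosReal :=
  ⟨D.init (x 0) * α⁻¹ ^ (x 0).val, mul_pos (hinit _) (pow_pos (inv_pos.2 hα) _)⟩

/-- The ratio of the two diagonal transition probabilities. -/
noncomputable def diagRatio (hα : 0 < α) (hβ : 0 < β) : PosReal :=
  ⟨(1 + α) / (1 + β), by positivity⟩

variable {D : MarkovData}

theorem weight_eq_pairPow (hα : 0 < α) (hβ : 0 < β) (hinit : ∀ a, 0 < D.init a)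
    (htrans : ∀ n, D.trans n = !![1 / (1 + α), α / (1 + α); β / (1 + β), 1 / (1 + β)])
    (n : ℕ) (x : ℕ → Fin 2) :
    D.weight n x = (1 / (1 + α)) ^ n * (initFactor D hinit hα x).1 *
      (pairPow (diagRatio hα hβ) ⟨α * β, mul_pos hα hβ⟩ (pathCount n x)).1 *
      α ^ (x n).val := by
  have h1 : 1 + α ≠ 0 := by positivity
  have h2 : 1 + β ≠ 0 := by positivity
  induction n with
  | zero =>
    have : pathCount 0 x = 0 := rfl
    rw [this, pairPow_zero]
    simp only [MarkovData.weight, initFactor, Finset.range_zero, Finset.prod_empty, pow_zero,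
      one_mul, mul_one, Positive.val_one]
    rw [mul_assoc, ← mul_pow, inv_mul_cancel₀ hα.ne', one_pow, mul_one]
  | succ n ih =>
    -- The factor `α ^ a` conjugates `P` by `diag(1, α)`. These factors telescope along a path,
    -- leaving one at each end: the first goes into `initFactor`, the last is common to sequences
    -- that agree from `n` on.
    have hstep : ∀ a b : Fin 2, α ^ a.val * D.trans n a b = 1 / (1 + α) *
        (pairPow (diagRatio hα hβ) ⟨α * β, mul_pos hα hβ⟩ (transitionCount a b)).1 *
        α ^ b.val := by
      intro a b
      rw [htrans]
      fin_cases a <;> fin_cases b <;>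
        simp [transitionCount, pairPow, diagRatio] <;> field_simp
    have hcount : pathCount (n + 1) x = pathCount n x + transitionCount (x n) (x (n + 1)) :=
      Finset.sum_range_succ _ _
    rw [MarkovData.weight_succ, ih, hcount, pairPow_add, mul_assoc, hstep, pow_succ,
      Positive.val_mul]
    ring

theorem hasCountWeights (hα : 0 < α) (hβ : 0 < β) (hinit : ∀ a, 0 < D.init a)
    (htrans : ∀ n, D.trans n = !![1 / (1 + α), α / (1 + α); β / (1 + β), 1 / (1 + β)]) :
    D.HasCountWeights (initFactor D hinit hα) (diagRatio hα hβ) ⟨α * β, mul_pos hα hβ⟩ where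
  init_pos := hinit
  exists_lower := by
    set P : Matrix (Fin 2) (Fin 2) ℝ := !![1 / (1 + α), α / (1 + α); β / (1 + β), 1 / (1 + β)]
      with hP
    have hpos : ∀ a b, 0 < P a b := by
      intro a b
      fin_cases a <;> fin_cases b <;> simp [hP] <;> positivity
    obtain ⟨p, hp⟩ := Finite.exists_min fun p : Fin 2 × Fin 2 => P p.1 p.2
    exact ⟨min (P p.1 p.2) 1, lt_min (hpos _ _) one_pos, min_le_right _ _,
      fun n a b => by rw [htrans]; exact (min_le_left _ _).trans (hp (a, b))⟩
  exists_upper := by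
    set P : Matrix (Fin 2) (Fin 2) ℝ := !![1 / (1 + α), α / (1 + α); β / (1 + β), 1 / (1 + β)]
      with hP
    have hlt : ∀ a b, P a b < 1 := by
      intro a b
      fin_cases a <;> fin_cases b <;> simp [hP] <;>
        first
        | (rw [div_lt_one (by positivity)]; linarith)
        | (exact inv_lt_one_of_one_lt₀ (by linarith))
    obtain ⟨p, hp⟩ := Finite.exists_max fun p : Fin 2 × Fin 2 => P p.1 p.2
    exact ⟨P p.1 p.2, hlt _ _, fun n a b => by rw [htrans]; exact hp (a, b)⟩
  measurable :=
    ((measurable_of_countable fun a : Fin 2 => D.init a * α⁻¹ ^ a.val).comp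
      (measurable_pi_apply (X := fun _ => Fin 2) 0)).subtype_mk
  weight_eq n x y h := by
    have hc : pathCount n y = pathCount n x + countCocycle x y := by
      rw [countCocycle_eq h]
      abel
    have hx : (initFactor D hinit hα x).1 ≠ 0 := (initFactor D hinit hα x).2.ne'
    rw [weight_eq_pairPow hα hβ hinit htrans, weight_eq_pairPow hα hβ hinit htrans, hc,
      pairPow_add, h n le_rfl, twistedCocycle, Positive.val_mul, Positive.val_mul,
      Positive.val_mul, Positive.coe_inv]
    field_simp

theorem exists_initFactor_inv_le (hα : 0 < α) (hinit : ∀ a, 0 < D.init a) :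
    ∃ C : ℝ, ∀ x, ((initFactor D hinit hα x)⁻¹).1 ≤ C := by
  obtain ⟨a, ha⟩ := Finite.exists_max fun a : Fin 2 => (D.init a * α⁻¹ ^ a.val)⁻¹
  exact ⟨_, fun x => ha (x 0)⟩

theorem diagRatio_eq_one_and_iff (hα : 0 < α) (hβ : 0 < β) :
    diagRatio hα hβ = 1 ∧ (⟨α * β, mul_pos hα hβ⟩ : PosReal) = 1 ↔ α = 1 ∧ β = 1 := by
  have h2 : 1 + β ≠ 0 := by positivity
  rw [Subtype.ext_iff, Subtype.ext_iff]
  simp only [diagRatio, Positive.val_one]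
  rw [div_eq_one_iff_eq h2]
  constructor
  · rintro ⟨h3, h4⟩
    obtain rfl : α = β := by linarith
    have : α = 1 := by nlinarith
    exact ⟨this, this⟩
  · rintro ⟨rfl, rfl⟩
    norm_num

/-- Multiply `1 + α = l^p (1 + β)` by `α` and substitute `αβ = l^(q-p)`. -/
theorem diagRatio_eq_zpow_and_iff (hα : 0 < α) (hβ : 0 < β) (l : PosReal) (p q : ℤ) :
    diagRatio hα hβ = l ^ p ∧ (⟨α * β, mul_pos hα hβ⟩ : PosReal) = l ^ (q - p) ↔
      α ^ 2 + (1 - l.1 ^ p) * α - l.1 ^ q = 0 ∧ β = l.1 ^ (q - p) / α := by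
  have h2 : 1 + β ≠ 0 := by positivity
  have hq : l.1 ^ q = l.1 ^ p * l.1 ^ (q - p) := by rw [← zpow_add₀ l.2.ne']; congr 1; ring
  rw [Subtype.ext_iff, Subtype.ext_iff]
  simp only [diagRatio, Positive.coe_zpow]
  rw [div_eq_iff h2, eq_div_iff hα.ne', hq, mul_comm β α]
  refine and_congr_left fun h => ?_
  rw [← h]
  constructor
  · intro h3
    linear_combination α * h3
  · intro h3
    refine mul_left_cancel₀ hα.ne' ?_
    linear_combination h3

end TwoState

theorem corollary6p2 (α β : ℝ) (hα : 0 < α) (hβ : 0 < β) (D : MarkovData)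
    (hinit : ∀ a, 0 < D.init a)
    (htrans : ∀ n, D.trans n = !![1 / (1 + α), α / (1 + α); β / (1 + β), 1 / (1 + β)]) :
    (IsTypeIIOne TailRel D.measure ↔ α = 1 ∧ β = 1) ∧
    (∀ (l : ℝ) (hl : 0 < l), l < 1 →
      (IsTypeIIILambda TailRel D.measure ⟨l, hl⟩ ↔
        ∃ p q : ℤ, IsCoprime p q ∧ α ^ 2 + (1 - l ^ p) * α - l ^ q = 0 ∧
          β = l ^ (q - p) / α)) ∧
    ((¬ IsTypeIIOne TailRel D.measure ∧
        ∀ (l : ℝ) (hl : 0 < l), l < 1 → ¬ IsTypeIIILambda TailRel D.measure ⟨l, hl⟩) →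
      IsTypeIIIOne TailRel D.measure) := by
  have H := hasCountWeights hα hβ hinit htrans
  obtain ⟨C, hC⟩ := exists_initFactor_inv_le hα hinit
  refine ⟨(H.isTypeIIOne_iff hC).trans (diagRatio_eq_one_and_iff hα hβ), fun l hl hl1 => ?_, ?_⟩
  · rw [H.isTypeIIILambda_iff hl1, zpowers_eq_iff hl1]
    exact exists₂_congr fun p q => and_congr_right fun _ =>
      diagRatio_eq_zpow_and_iff hα hβ ⟨l, hl⟩ p q
  · rintro ⟨h1, h2⟩
    have hne := mt (H.isTypeIIOne_iff hC).2 h1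
    refine ⟨H.isTypeIII hne, _, H.isRadonNikodymCocycle, ?_⟩
    rcases denseRange_pairPow_or_exists (diagRatio hα hβ) ⟨α * β, mul_pos hα hβ⟩ with h | h | h
    · exact H.isErgodicCocycle_of_dense h
    · exact absurd h hne
    · obtain ⟨l, hl, h⟩ := h
      exact absurd ((H.isTypeIIILambda_iff hl).2 h) (h2 l.1 l.2 hl)
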